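/- \textbf{Theorem.} Let $n\ge 1$, $s\in(0,1)$ and $0<\lambda\le\Lambda$. There is a constant $C>0$, depending only on $n,s,\lambda,\Lambda$, with the following property. Let $K\in L^1_{\rm loc}(\mathbb{R}^n\setminus\{0\})$ be nonnegative and positively homogeneous of degree $-n-2s$, with $$\frac{\lambda}{|y|^{n+2s}}\le K(y)\le\frac{\Lambda}{|y|^{n+2s}}\qquad (y\ne0),$$ and, if $s=\frac12$, also $\int_{\partial B_1}y\,K(y)\,d\mathcal H^{n-1}(y)=0$; let $b\in\mathbb{R}^n$, with $|b|\le\Lambda$ if $s=\frac12$. Let $$Lu(x)=\begin{cases}\int_{\mathbb{R}^n}(u(x)-u(x+y))K(y)\,dy, & s<\frac12,\\ \mathrm{P.V.}\int_{\mathbb{R}^n}(u(x)-u(x+y))K(y)\,dy+b\cdot\nabla u(x), & s=\frac12,\\ \int_{\mathbb{R}^n}(u(x)-u(x+y)+\nabla u(x)\cdot y)K(y)\,dy, & s>\frac12,\end{cases}$$ and let $L^*$ be the operator of the same form with kernel $K(-y)$ and drift $-b$. Let $C_0>0$ and let $u:\mathbb{R}^n\to\mathbb{R}$ be measurable with $\int_{\mathbb{R}^n}\frac{|u(x)|}{1+|x|^{n+2s}}\,dx<\infty$.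 If $Lu\le C_0$ in $B_1$ in the weak or in the viscosity sense, then $$\sup_{B_{1/2}}u\le C\left(\int_{\mathbb{R}^n}\frac{|u(x)|}{1+|x|^{n+2s}}\,dx+C_0\right),$$ where the supremum is the essential supremum in the weak case and the pointwise supremum in the viscosity case. Here $Lu\le C_0$ in $B_1$ in the weak sense means that $\int_{\mathbb{R}^n}u\,L^*\eta\,dx\le\int_{B_1}C_0\,\eta\,dx$ for all $\eta\in C^\infty_c(B_1)$ with $\eta\ge0$. In the viscosity sense it means that $u$ is upper semicontinuous in $B_1$ and that, whenever $B_r(x_0)\subset B_1$ with $r>0$, $\varphi\in C^2(\mathbb{R}^n)$, $\varphi(x_0)=u(x_0)$ and $\varphi\ge u$ in $B_r(x_0)$, the function $w$ equal to $\varphi$ in $B_r(x_0)$ and to $u$ elsewhere satisfies $Lw(x_0)\le C_0$. -/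

import Mathlib

open Set Filter Topology MeasureTheory
open scoped ContDiff

/-- Admissible kernels: locally integrable away from the origin, nonnegative, positively homogeneous
of degree `-n-2s`, with vanishing first moment on the unit sphere (with respect to the surface
measure) when `s = 1/2`. The value at the origin plays no role. -/
structure IsStableKernel {n : ℕ} (s : ℝ) (K : EuclideanSpace ℝ (Fin n) → ℝ) : Prop where
  locallyIntegrable : LocallyIntegrableOn K {0}ᶜ volume
  nonneg : ∀ y, y ≠ 0 → 0 ≤ K y
  homogeneous : ∀ t : ℝ, 0 < t → ∀ y, y ≠ 0 → K (t • y) = t ^ (-(n : ℝ) - 2 * s) * K y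
  cancellation : s = 1 / 2 →
    ∫ θ : Metric.sphere (0 : EuclideanSpace ℝ (Fin n)) 1,
      K (θ : EuclideanSpace ℝ (Fin n)) • (θ : EuclideanSpace ℝ (Fin n))
        ∂((volume : Measure (EuclideanSpace ℝ (Fin n))).toSphere) = 0

/-- The stable operator of order `2s` with kernel `K` and (only if `s = 1/2`) drift `b`, evaluated at
`x`. For `s = 1/2` the integral is a principal value. Here `fderiv ℝ u x v` is `∇u(x) · v`. -/
noncomputable def stableOp {n : ℕ} (s : ℝ) (K : EuclideanSpace ℝ (Fin n) → ℝ)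
    (b : EuclideanSpace ℝ (Fin n)) (u : EuclideanSpace ℝ (Fin n) → ℝ)
    (x : EuclideanSpace ℝ (Fin n)) : ℝ :=
  if s < 1 / 2 then
    ∫ y, (u x - u (x + y)) * K y
  else if s = 1 / 2 then
    limUnder (𝓝[>] (0 : ℝ)) (fun ε => ∫ y in {y | ε < ‖y‖}, (u x - u (x + y)) * K y)
      + fderiv ℝ u x b
  else
    ∫ y, (u x - u (x + y) + fderiv ℝ u x y) * K y

/-- The even part of a kernel. -/
noncomputable def evenPart {n : ℕ} (K : EuclideanSpace ℝ (Fin n) → ℝ) :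
    EuclideanSpace ℝ (Fin n) → ℝ := fun y => (K y + K (-y)) / 2

/-- The odd part of a kernel. -/
noncomputable def oddPart {n : ℕ} (K : EuclideanSpace ℝ (Fin n) → ℝ) :
    EuclideanSpace ℝ (Fin n) → ℝ := fun y => (K y - K (-y)) / 2

/-- The adjoint operator: kernel `K_e - K_o` and drift `-b`. -/
noncomputable def stableOpAdj {n : ℕ} (s : ℝ) (K : EuclideanSpace ℝ (Fin n) → ℝ)
    (b : EuclideanSpace ℝ (Fin n)) (η : EuclideanSpace ℝ (Fin n) → ℝ)
    (x : EuclideanSpace ℝ (Fin n)) : ℝ :=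
  stableOp s (fun y => evenPart K y - oddPart K y) (-b) η x

/-- `L u ≤ f` in `Ω` in the weak sense: `∫ u L^*η ≤ ∫_Ω f η` for all nonnegative
`η ∈ C_c^∞(Ω)`. -/
def IsWeakSubsolution {n : ℕ} (s : ℝ) (K : EuclideanSpace ℝ (Fin n) → ℝ)
    (b : EuclideanSpace ℝ (Fin n)) (Ω : Set (EuclideanSpace ℝ (Fin n)))
    (f u : EuclideanSpace ℝ (Fin n) → ℝ) : Prop :=
  ∀ η : EuclideanSpace ℝ (Fin n) → ℝ, ContDiff ℝ ∞ η → HasCompactSupport η → tsupport η ⊆ Ω →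
    (∀ x, 0 ≤ η x) →
    ∫ x, u x * stableOpAdj s K b η x ≤ ∫ x in Ω, f x * η x

open Classical in
/-- `L u ≤ f` in `Ω` in the viscosity sense: `u` is upper semicontinuous in `Ω`, and whenever a `C²`
function `φ` touches `u` from above at `x₀` in a ball `B_r(x₀) ⊆ Ω`, the function equal to `φ` in
`B_r(x₀)` and to `u` elsewhere, call it `w`, satisfies `L w (x₀) ≤ f x₀`. -/
def IsViscositySubsolution {n : ℕ} (s : ℝ) (K : EuclideanSpace ℝ (Fin n) → ℝ)
    (b : EuclideanSpace ℝ (Fin n)) (Ω : Set (EuclideanSpace ℝ (Fin n)))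
    (f u : EuclideanSpace ℝ (Fin n) → ℝ) : Prop :=
  UpperSemicontinuousOn u Ω ∧
  ∀ x₀ ∈ Ω, ∀ r : ℝ, 0 < r → Metric.ball x₀ r ⊆ Ω →
    ∀ φ : EuclideanSpace ℝ (Fin n) → ℝ, ContDiff ℝ 2 φ → φ x₀ = u x₀ →
      (∀ y ∈ Metric.ball x₀ r, u y ≤ φ y) →
      stableOp s K b ((Metric.ball x₀ r).piecewise φ u) x₀ ≤ f x₀

/-! ### Radial integrals -/

section Radial

/-! For viscosity subsolutions the proof is a weighted maximum principle. Put `q(x) = 9/16 - |x|²`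
and let `x₀` maximize `max u 0 * q ^ n` over the closed ball of radius `3/4`; only `u x₀ > 0` and
`q₀ = q(x₀) > 0` matter. Maximality says `u ≤ u(x₀) (q₀ / q) ^ n`, so on a ball of radius `r = θ q₀`
about `x₀` the function lies below a quadratic polynomial with value `u(x₀)`, gradient of size
`u(x₀) / q₀` and second order part of size `u(x₀) / q₀²` (`exists_quadratic_above`).

Testing with this polynomial (`IsViscositySubsolution.quadratic_test`), the increments outside the
ball contribute at least `c λ r ^ (-2s) u(x₀)`, minus a tail of order `r ^ (-n-2s)` times the
weighted norm. The second and first order terms are of order `r ^ (2-2s) u(x₀) / q₀²` and `r ^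
(1-2s) u(x₀) / q₀`, that is, `θ²` and `θ` times `r ^ (-2s) u(x₀)`. A small `θ` absorbs them. What
remains is `u(x₀) ≤ C (r ^ (-n) N + C₀)`, and the factor `q₀ ^ n` exactly cancels the blow-up `r ^
(-n)` (`absorb_lower_order`). On the ball of radius `1/2` the weight is bounded below.

For weak subsolutions, testing with translates of a mollifier and using Fubini shows that the
mollified function satisfies the inequality pointwise in the ball of radius `7/8`
(`IsWeakSubsolution.mollify_le`). It is therefore a viscosity subsolution there, its weighted norm
is controlled by that of `u`, and the bound passes to the almost everywhere limit.

The three cases of `s` are treated together by writing the operator as one absolutely convergent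
integral of compensated increments (`IsEllipticKernel.stableOp_eq`). -/

theorem indicator_compl_ball_comp_norm {n : ℕ} (r : ℝ) (f : ℝ → ℝ) (y : EuclideanSpace ℝ (Fin n)) :
    (Metric.ball (0 : EuclideanSpace ℝ (Fin n)) r)ᶜ.indicator (fun y => f ‖y‖) y
      = (Ici r).indicator f ‖y‖ := by
  simp [indicator]

variable {n : ℕ} [NeZero n]

theorem pow_pred_mul_rpow {n : ℕ} [NeZero n] {t : ℝ} (ht : 0 < t) (a : ℝ) :
    t ^ (n - 1) * t ^ a = t ^ ((n : ℝ) + a - 1) := by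
  have hn : 1 ≤ n := Nat.one_le_iff_ne_zero.2 (NeZero.ne n)
  rw [← Real.rpow_natCast, ← Real.rpow_add ht, Nat.cast_sub hn]
  congr 1
  push_cast
  ring

theorem integrableOn_ball_norm_rpow {a r : ℝ} (ha : -(n : ℝ) < a) (hr : 0 < r) :
    IntegrableOn (fun y : EuclideanSpace ℝ (Fin n) => ‖y‖ ^ a) (Metric.ball 0 r) := by
  rw [integrableOn_fun_norm_addHaar volume (f := fun t => t ^ a)]
  have h : IntegrableOn (fun t : ℝ => t ^ ((n : ℝ) + a - 1)) (Ioo 0 r) := by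
    rw [intervalIntegral.integrableOn_Ioo_rpow_iff hr]
    linarith
  refine h.congr_fun (fun t ht => ?_) measurableSet_Ioo
  simp only [finrank_euclideanSpace, Fintype.card_fin, smul_eq_mul]
  exact (pow_pred_mul_rpow ht.1 a).symm

theorem setIntegral_ball_norm_rpow {a r : ℝ} (ha : -(n : ℝ) < a) (hr : 0 < r) :
    ∫ y in Metric.ball (0 : EuclideanSpace ℝ (Fin n)) r, ‖y‖ ^ a =
      n * volume.real (Metric.ball (0 : EuclideanSpace ℝ (Fin n)) 1) / (n + a)
        * r ^ ((n : ℝ) + a) := by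
  have h1 : ∀ y : EuclideanSpace ℝ (Fin n), (Metric.ball (0 : EuclideanSpace ℝ (Fin n)) r).indicator
      (fun y => ‖y‖ ^ a) y = (Iio r).indicator (fun t : ℝ => t ^ a) ‖y‖ := by
    intro y
    simp [indicator]
  rw [← integral_indicator Metric.isOpen_ball.measurableSet]
  simp_rw [h1]
  rw [integral_fun_norm_addHaar volume (fun t => (Iio r).indicator (fun t : ℝ => t ^ a) t)]
  have h2 : ∫ t in Ioi (0 : ℝ), t ^ (n - 1) * (Iio r).indicator (fun t : ℝ => t ^ a) t
      = r ^ ((n : ℝ) + a) / (n + a) := by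
    have : ∀ t ∈ Ioi (0 : ℝ), t ^ (n - 1) * (Iio r).indicator (fun t : ℝ => t ^ a) t
        = (Iio r).indicator (fun t : ℝ => t ^ ((n : ℝ) + a - 1)) t := by
      intro t ht
      by_cases h : t < r
      · simp [indicator, h, pow_pred_mul_rpow (mem_Ioi.1 ht) a]
      · simp [indicator, h]
    rw [setIntegral_congr_fun measurableSet_Ioi this, setIntegral_indicator measurableSet_Iio,
      Ioi_inter_Iio, ← integral_Ioc_eq_integral_Ioo, ← intervalIntegral.integral_of_le hr.le,
      integral_rpow (Or.inl (by linarith)), sub_add_cancel, Real.zero_rpow (by linarith), sub_zero]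
  simp only [finrank_euclideanSpace, Fintype.card_fin, smul_eq_mul, nsmul_eq_mul]
  rw [h2]
  ring

theorem pow_pred_mul_indicator_Ici (r a : ℝ) {t : ℝ} (ht : t ∈ Ioi (0 : ℝ)) :
    t ^ (n - 1) * (Ici r).indicator (fun t : ℝ => t ^ a) t
      = (Ici r).indicator (fun t : ℝ => t ^ ((n : ℝ) + a - 1)) t := by
  by_cases h : r ≤ t
  · simp [indicator, h, pow_pred_mul_rpow (mem_Ioi.1 ht) a]
  · simp [indicator, h]

theorem Ioi_zero_inter_Ici {r : ℝ} (hr : 0 < r) : Ioi (0 : ℝ) ∩ Ici r = Ici r :=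
  inter_eq_right.2 fun _ ht => lt_of_lt_of_le hr ht

theorem integrableOn_compl_ball_norm_rpow {a r : ℝ} (ha : a < -(n : ℝ)) (hr : 0 < r) :
    IntegrableOn (fun y : EuclideanSpace ℝ (Fin n) => ‖y‖ ^ a) (Metric.ball 0 r)ᶜ := by
  rw [← integrable_indicator_iff Metric.isOpen_ball.measurableSet.compl]
  rw [funext (indicator_compl_ball_comp_norm r (fun t => t ^ a)),
    integrable_fun_norm_addHaar volume (f := (Ici r).indicator (fun t => t ^ a))]
  simp only [finrank_euclideanSpace, Fintype.card_fin, smul_eq_mul]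
  rw [integrableOn_congr_fun (fun t ht => pow_pred_mul_indicator_Ici r a ht) measurableSet_Ioi,
    IntegrableOn, integrable_indicator_iff measurableSet_Ici, IntegrableOn,
    Measure.restrict_restrict measurableSet_Ici, inter_comm, Ioi_zero_inter_Ici hr]
  have := integrableOn_Ioi_rpow_of_lt (a := (n : ℝ) + a - 1) (by linarith) hr
  rwa [← integrableOn_Ici_iff_integrableOn_Ioi] at this

theorem setIntegral_compl_ball_norm_rpow {a r : ℝ} (ha : a < -(n : ℝ)) (hr : 0 < r) :
    ∫ y in (Metric.ball (0 : EuclideanSpace ℝ (Fin n)) r)ᶜ, ‖y‖ ^ a =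
      n * volume.real (Metric.ball (0 : EuclideanSpace ℝ (Fin n)) 1) / (-(n + a))
        * r ^ ((n : ℝ) + a) := by
  rw [← integral_indicator Metric.isOpen_ball.measurableSet.compl]
  simp_rw [indicator_compl_ball_comp_norm r (fun t => t ^ a)]
  rw [integral_fun_norm_addHaar volume (fun t => (Ici r).indicator (fun t : ℝ => t ^ a) t)]
  simp only [finrank_euclideanSpace, Fintype.card_fin, smul_eq_mul, nsmul_eq_mul]
  rw [setIntegral_congr_fun measurableSet_Ioi (fun t ht => pow_pred_mul_indicator_Ici r a ht),
    setIntegral_indicator measurableSet_Ici, Ioi_zero_inter_Ici hr, integral_Ici_eq_integral_Ioi,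
    integral_Ioi_rpow_of_lt (by linarith) hr, sub_add_cancel, div_neg, neg_div]
  ring

end Radial

/-! ### Elliptic stable kernels -/

section Kernel

/-- Measurable kernels comparable to the kernel of the fractional Laplacian, with vanishing first
moment on annuli if `s = 1/2`. -/
structure IsEllipticKernel {n : ℕ} (s lam Lam : ℝ) (K : EuclideanSpace ℝ (Fin n) → ℝ) : Prop where
  aestronglyMeasurable : AEStronglyMeasurable K volume
  nonneg : ∀ y, y ≠ 0 → 0 ≤ K y
  annulus : s = 1 / 2 → ∀ ε r : ℝ,
    ∫ y in {y : EuclideanSpace ℝ (Fin n) | ε < ‖y‖ ∧ ‖y‖ < r}, K y • y = 0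
  lower : ∀ y, y ≠ 0 → lam * ‖y‖ ^ (-((n : ℝ) + 2 * s)) ≤ K y
  upper : ∀ y, y ≠ 0 → K y ≤ Lam * ‖y‖ ^ (-((n : ℝ) + 2 * s))

/-- The weighted `L¹` norm. -/
noncomputable def tailNorm {n : ℕ} (s : ℝ) (u : EuclideanSpace ℝ (Fin n) → ℝ) : ℝ :=
  ∫ y, |u y| / (1 + ‖y‖ ^ ((n : ℝ) + 2 * s))

/-- The constant in the moment bounds for stable kernels. -/
noncomputable def momentConst (n : ℕ) (s β : ℝ) : ℝ :=
  n * volume.real (Metric.ball (0 : EuclideanSpace ℝ (Fin n)) 1) / |β - 2 * s|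

theorem momentConst_nonneg (n : ℕ) (s β : ℝ) : 0 ≤ momentConst n s β := by
  unfold momentConst
  positivity

theorem momentConst_pos (n : ℕ) [NeZero n] {s β : ℝ} (h : β ≠ 2 * s) : 0 < momentConst n s β := by
  have h1 : 0 < volume.real (Metric.ball (0 : EuclideanSpace ℝ (Fin n)) 1) :=
    ENNReal.toReal_pos (Metric.measure_ball_pos _ _ one_pos).ne' measure_ball_lt_top.ne
  have h2 : 0 < (n : ℝ) := Nat.cast_pos.2 (Nat.pos_of_ne_zero (NeZero.ne n))
  have h3 : 0 < |β - 2 * s| := abs_pos.2 (sub_ne_zero.2 h)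
  unfold momentConst
  positivity

variable {n : ℕ} [NeZero n] {s lam Lam : ℝ} {K : EuclideanSpace ℝ (Fin n) → ℝ}

theorem ae_ne_zero_euclidean : ∀ᵐ y : EuclideanSpace ℝ (Fin n), y ≠ 0 := by
  simp [ae_iff]

omit [NeZero n] in
theorem IsEllipticKernel.abs_mul_le (hK : IsEllipticKernel s lam Lam K) {G β c : ℝ}
    {y : EuclideanSpace ℝ (Fin n)} (hy : y ≠ 0) (hc : |c| ≤ G * ‖y‖ ^ β) :
    |c * K y| ≤ G * Lam * ‖y‖ ^ (β - ((n : ℝ) + 2 * s)) := by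
  have hy' : 0 < ‖y‖ := norm_pos_iff.2 hy
  rw [abs_mul, abs_of_nonneg (hK.nonneg y hy), sub_eq_add_neg, Real.rpow_add hy']
  calc |c| * K y ≤ (G * ‖y‖ ^ β) * (Lam * ‖y‖ ^ (-((n : ℝ) + 2 * s))) :=
        mul_le_mul hc (hK.upper y hy) (hK.nonneg y hy) ((abs_nonneg c).trans hc)
    _ = _ := by ring

/-- Vanishing of order `β > 2s` at the origin beats the singularity of the kernel. The power of `r`
is the one dictated by scaling; `far` is the counterpart for growth `β < 2s` at infinity. -/
theorem IsEllipticKernel.near (hK : IsEllipticKernel s lam Lam K) {G β r : ℝ}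
    (hβ : 2 * s < β) (hr : 0 < r) {g : EuclideanSpace ℝ (Fin n) → ℝ}
    (hg : AEStronglyMeasurable g volume) (hgG : ∀ y ∈ Metric.ball 0 r, |g y| ≤ G * ‖y‖ ^ β) :
    IntegrableOn (fun y => g y * K y) (Metric.ball 0 r) ∧
      |∫ y in Metric.ball 0 r, g y * K y| ≤ G * Lam * (momentConst n s β * r ^ (β - 2 * s)) := by
  have hb : ∀ᵐ y ∂(volume.restrict (Metric.ball (0 : EuclideanSpace ℝ (Fin n)) r)),
      ‖g y * K y‖ ≤ G * Lam * ‖y‖ ^ (β - ((n : ℝ) + 2 * s)) := by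
    rw [ae_restrict_iff' Metric.isOpen_ball.measurableSet]
    filter_upwards [ae_ne_zero_euclidean] with y hy hyr
    exact hK.abs_mul_le hy (hgG y hyr)
  have hi := (integrableOn_ball_norm_rpow (n := n) (a := β - ((n : ℝ) + 2 * s)) (by linarith) hr
    ).const_mul (G * Lam)
  refine ⟨Integrable.mono' hi (hg.mul hK.aestronglyMeasurable).restrict hb, ?_⟩
  refine (norm_integral_le_of_norm_le hi hb).trans_eq ?_
  rw [integral_const_mul, setIntegral_ball_norm_rpow (by linarith) hr, momentConst,
    abs_of_pos (by linarith)]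
  ring_nf

theorem IsEllipticKernel.far (hK : IsEllipticKernel s lam Lam K) {G β r : ℝ}
    (hβ : β < 2 * s) (hr : 0 < r) {g : EuclideanSpace ℝ (Fin n) → ℝ}
    (hg : AEStronglyMeasurable g volume) (hgG : ∀ y ∈ (Metric.ball 0 r)ᶜ, |g y| ≤ G * ‖y‖ ^ β) :
    IntegrableOn (fun y => g y * K y) (Metric.ball 0 r)ᶜ ∧
      |∫ y in (Metric.ball 0 r)ᶜ, g y * K y|
        ≤ G * Lam * (momentConst n s β * r ^ (β - 2 * s)) := by
  have hb : ∀ᵐ y ∂(volume.restrict (Metric.ball (0 : EuclideanSpace ℝ (Fin n)) r)ᶜ),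
      ‖g y * K y‖ ≤ G * Lam * ‖y‖ ^ (β - ((n : ℝ) + 2 * s)) := by
    rw [ae_restrict_iff' Metric.isOpen_ball.measurableSet.compl]
    filter_upwards [ae_ne_zero_euclidean] with y hy hyr
    exact hK.abs_mul_le hy (hgG y hyr)
  have hi := (integrableOn_compl_ball_norm_rpow (n := n) (a := β - ((n : ℝ) + 2 * s))
    (by linarith) hr).const_mul (G * Lam)
  refine ⟨Integrable.mono' hi (hg.mul hK.aestronglyMeasurable).restrict hb, ?_⟩
  refine (norm_integral_le_of_norm_le hi hb).trans_eq ?_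
  rw [integral_const_mul, setIntegral_compl_ball_norm_rpow (by linarith) hr, momentConst,
    abs_of_neg (by linarith)]
  ring_nf

theorem IsEllipticKernel.integrableOn_far (hK : IsEllipticKernel s lam Lam K) (hs₀ : 0 < s)
    {r : ℝ} (hr : 0 < r) : IntegrableOn K (Metric.ball 0 r)ᶜ := by
  have h := (hK.far (G := 1) (β := 0) (g := fun _ => 1) (by linarith) hr
    aestronglyMeasurable_const (by simp)).1
  simpa using h

/-- Here the ellipticity from below enters the estimate: this mass, multiplied by the value at the
maximum point, is the leading term that absorbs the others. -/
theorem IsEllipticKernel.lower_far (hK : IsEllipticKernel s lam Lam K) (hs₀ : 0 < s)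
    {r : ℝ} (hr : 0 < r) :
    lam * (momentConst n s 0 * r ^ (-(2 * s))) ≤ ∫ y in (Metric.ball 0 r)ᶜ, K y := by
  have h : lam * (momentConst n s 0 * r ^ (-(2 * s))) =
      ∫ y in (Metric.ball (0 : EuclideanSpace ℝ (Fin n)) r)ᶜ,
        lam * ‖y‖ ^ (-((n : ℝ) + 2 * s)) := by
    rw [integral_const_mul, setIntegral_compl_ball_norm_rpow (by linarith) hr, momentConst,
      abs_of_neg (by linarith)]
    ring_nf
  rw [h]
  refine setIntegral_mono_on ((integrableOn_compl_ball_norm_rpow (by linarith) hr).const_mul _)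
    (hK.integrableOn_far hs₀ hr) Metric.isOpen_ball.measurableSet.compl fun y hy => hK.lower y ?_
  rintro rfl
  simp [hr.not_ge] at hy

omit [NeZero n] in
-- Both `1` and `‖z‖` are controlled by `‖y‖ / r`, the latter with factor `3`. The loss `r ^ (-α)`,
-- with `α = n + 2s`, is what later forces the exponent `n` of the weight.
theorem one_add_norm_rpow_le {α r : ℝ} (hα : 0 < α) (hr : 0 < r) (hr1 : r ≤ 1)
    {y z : EuclideanSpace ℝ (Fin n)} (hy : r ≤ ‖y‖) (hz : ‖z‖ ≤ 2 + ‖y‖) :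
    1 + ‖z‖ ^ α ≤ (1 + 3 ^ α) * r ^ (-α) * ‖y‖ ^ α := by
  have hy0 : 0 < ‖y‖ := hr.trans_le hy
  have h1 : 1 ≤ ‖y‖ / r := (one_le_div hr).2 hy
  have h2 : ‖z‖ ≤ 3 * (‖y‖ / r) := by
    have : ‖y‖ ≤ ‖y‖ / r := by
      rw [le_div_iff₀ hr]
      nlinarith
    linarith
  have h3 : ‖z‖ ^ α ≤ 3 ^ α * (‖y‖ / r) ^ α := by
    rw [← Real.mul_rpow (by norm_num) (by positivity)]
    exact Real.rpow_le_rpow (norm_nonneg _) h2 hα.le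
  have h4 : 1 ≤ (‖y‖ / r) ^ α := Real.one_le_rpow h1 hα.le
  have h5 : (1 + 3 ^ α) * r ^ (-α) * ‖y‖ ^ α = (1 + 3 ^ α) * (‖y‖ / r) ^ α := by
    rw [Real.div_rpow hy0.le hr.le, Real.rpow_neg hr.le]
    field_simp
  rw [h5]
  nlinarith

omit [NeZero n] in
theorem IsEllipticKernel.mul_le_weight (hK : IsEllipticKernel s lam Lam K) (hs₀ : 0 < s)
    (hLam : 0 ≤ Lam) {r : ℝ} (hr : 0 < r) (hr1 : r ≤ 1)
    {y z : EuclideanSpace ℝ (Fin n)} (hy : r ≤ ‖y‖) (hz : ‖z‖ ≤ 2 + ‖y‖) :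
    K y ≤ Lam * ((1 + 3 ^ ((n : ℝ) + 2 * s)) * r ^ (-((n : ℝ) + 2 * s))) *
      (1 + ‖z‖ ^ ((n : ℝ) + 2 * s))⁻¹ := by
  have hα : 0 < (n : ℝ) + 2 * s := by positivity
  have hy0 : 0 < ‖y‖ := hr.trans_le hy
  have h := one_add_norm_rpow_le hα hr hr1 hy hz
  refine (hK.upper y (norm_pos_iff.1 hy0)).trans ?_
  rw [mul_assoc]
  refine mul_le_mul_of_nonneg_left ?_ hLam
  rw [Real.rpow_neg hy0.le, ← div_eq_mul_inv, inv_eq_one_div, div_le_div_iff₀ (by positivity)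
    (by positivity), one_mul]
  exact h

omit [NeZero n] in
theorem IsEllipticKernel.tail (hK : IsEllipticKernel s lam Lam K) (hs₀ : 0 < s)
    (hLam : 0 ≤ Lam) {r : ℝ} (hr : 0 < r) (hr1 : r ≤ 1) {v : EuclideanSpace ℝ (Fin n) → ℝ}
    (hv : AEStronglyMeasurable v volume)
    (hvi : Integrable (fun y => |v y| / (1 + ‖y‖ ^ ((n : ℝ) + 2 * s))))
    {x : EuclideanSpace ℝ (Fin n)} (hx : ‖x‖ ≤ 1) :
    IntegrableOn (fun y => v (x + y) * K y) (Metric.ball 0 r)ᶜ ∧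
      |∫ y in (Metric.ball 0 r)ᶜ, v (x + y) * K y| ≤
        Lam * ((1 + 3 ^ ((n : ℝ) + 2 * s)) * r ^ (-((n : ℝ) + 2 * s))) * tailNorm s v := by
  set c := Lam * ((1 + 3 ^ ((n : ℝ) + 2 * s)) * r ^ (-((n : ℝ) + 2 * s)))
  have hi : Integrable (fun y => c * (|v (x + y)| / (1 + ‖x + y‖ ^ ((n : ℝ) + 2 * s)))) :=
    (hvi.comp_add_left x).const_mul c
  have hb : ∀ᵐ y ∂(volume.restrict (Metric.ball (0 : EuclideanSpace ℝ (Fin n)) r)ᶜ),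
      ‖v (x + y) * K y‖ ≤ c * (|v (x + y)| / (1 + ‖x + y‖ ^ ((n : ℝ) + 2 * s))) := by
    rw [ae_restrict_iff' Metric.isOpen_ball.measurableSet.compl]
    refine Eventually.of_forall fun y hy => ?_
    have hy : r ≤ ‖y‖ := by simpa using hy
    have hz : ‖x + y‖ ≤ 2 + ‖y‖ := (norm_add_le x y).trans (by linarith)
    have hy0 : y ≠ 0 := norm_pos_iff.1 (hr.trans_le hy)
    rw [norm_mul, Real.norm_eq_abs, Real.norm_eq_abs, abs_of_nonneg (hK.nonneg y hy0)]
    calc |v (x + y)| * K y ≤ |v (x + y)| * (c * (1 + ‖x + y‖ ^ ((n : ℝ) + 2 * s))⁻¹) :=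
          mul_le_mul_of_nonneg_left (hK.mul_le_weight hs₀ hLam hr hr1 hy hz) (abs_nonneg _)
      _ = _ := by rw [div_eq_mul_inv]; ring
  have hm : AEStronglyMeasurable (fun y => v (x + y)) volume :=
    hv.comp_quasiMeasurePreserving (measurePreserving_add_left volume x).quasiMeasurePreserving
  refine ⟨Integrable.mono' hi.integrableOn (hm.mul hK.aestronglyMeasurable).restrict hb, ?_⟩
  refine (norm_integral_le_of_norm_le hi.integrableOn hb).trans ?_
  refine (setIntegral_le_integral hi (Eventually.of_forall fun y => ?_)).trans_eq ?_
  · have : 0 ≤ c := by positivity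
    simp only [Pi.zero_apply]
    positivity
  · rw [integral_const_mul, tailNorm]
    congr 1
    exact integral_add_left_eq_self (fun y => |v y| / (1 + ‖y‖ ^ ((n : ℝ) + 2 * s))) x

/-! ### The compensated form of the operator -/

/-- The truncation of the gradient term compensating the increments. -/
noncomputable def gradCutoff {n : ℕ} (s r : ℝ) (y : EuclideanSpace ℝ (Fin n)) : ℝ :=
  if s < 1 / 2 then 0 else if s = 1 / 2 then (Metric.ball 0 r).indicator (fun _ => 1) y else 1

/-- The drift, which is present only in the critical case. -/
noncomputable def criticalDrift {n : ℕ} (s : ℝ) (b : EuclideanSpace ℝ (Fin n)) :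
    EuclideanSpace ℝ (Fin n) := if s = 1 / 2 then b else 0

omit [NeZero n] in
theorem gradCutoff_of_lt (h : s < 1 / 2) (r : ℝ) (y : EuclideanSpace ℝ (Fin n)) :
    gradCutoff s r y = 0 := if_pos h

omit [NeZero n] in
theorem gradCutoff_of_eq (h : s = 1 / 2) (r : ℝ) (y : EuclideanSpace ℝ (Fin n)) :
    gradCutoff s r y = (Metric.ball 0 r).indicator (fun _ => 1) y := by
  rw [gradCutoff, if_neg h.not_lt, if_pos h]

omit [NeZero n] in
theorem gradCutoff_of_gt (h : 1 / 2 < s) (r : ℝ) (y : EuclideanSpace ℝ (Fin n)) :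
    gradCutoff s r y = 1 := by
  rw [gradCutoff, if_neg h.not_gt, if_neg h.ne']

omit [NeZero n] in
theorem measurable_indicator_ball (r : ℝ) :
    Measurable ((Metric.ball (0 : EuclideanSpace ℝ (Fin n)) r).indicator (fun _ => (1 : ℝ))) :=
  measurable_const.indicator Metric.isOpen_ball.measurableSet

omit [NeZero n] in
theorem measurable_gradCutoff (s r : ℝ) :
    Measurable (gradCutoff s r : EuclideanSpace ℝ (Fin n) → ℝ) := by
  unfold gradCutoff
  split_ifs
  · exact measurable_const
  · exact measurable_indicator_ball r
  · exact measurable_const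

omit [NeZero n] in
theorem gradCutoff_neg (s r : ℝ) (y : EuclideanSpace ℝ (Fin n)) :
    gradCutoff s r (-y) = gradCutoff s r y := by
  simp [gradCutoff, indicator]

/-- The mismatch between the compensator of the operator and the one cut off to the ball lives
inside the ball if `s < 1/2`, where `|y| K` is integrable at the origin, and outside it if `s >
1/2`, where `|y| K` is integrable at infinity. For `s = 1/2` it vanishes, so it does not matter that
`momentConst n s 1` is then a division by zero. Linearity of `l` is not required, so that `l = ‖·‖`
can serve as a majorant. -/
theorem IsEllipticKernel.first_order (hK : IsEllipticKernel s lam Lam K) (hLam : 0 ≤ Lam)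
    {r : ℝ} (hr : 0 < r) {l : EuclideanSpace ℝ (Fin n) → ℝ} {G : ℝ}
    (hG : 0 ≤ G) (hlm : AEStronglyMeasurable l volume) (hl : ∀ y, |l y| ≤ G * ‖y‖) :
    Integrable (fun y => (gradCutoff s r y - (Metric.ball 0 r).indicator (fun _ => 1) y) * l y
      * K y) ∧
    |∫ y, (gradCutoff s r y - (Metric.ball 0 r).indicator (fun _ => 1) y) * l y * K y| ≤
      G * Lam * (momentConst n s 1 * r ^ (1 - 2 * s)) := by
  have hl : ∀ y, |l y| ≤ G * ‖y‖ ^ (1 : ℝ) := fun y => by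
    simpa using hl y
  rcases lt_trichotomy s (1 / 2) with h | h | h
  · have he : (fun y => (gradCutoff s r y - (Metric.ball 0 r).indicator (fun _ => 1) y) * l y
        * K y) = (Metric.ball 0 r).indicator (fun y => -l y * K y) := by
      ext y
      by_cases hy : y ∈ Metric.ball 0 r <;> simp [gradCutoff_of_lt h, -Metric.mem_ball, hy]
    have := hK.near (G := G) (β := 1) (g := fun y => -l y) (by linarith) hr
      hlm.neg (fun y _ => by rw [abs_neg]; exact hl y)
    rw [he, integral_indicator Metric.isOpen_ball.measurableSet,
      integrable_indicator_iff Metric.isOpen_ball.measurableSet]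
    exact this
  · have he : (fun y => (gradCutoff s r y - (Metric.ball 0 r).indicator (fun _ => 1) y) * l y
        * K y) = fun _ => 0 := by
      ext y
      simp [gradCutoff_of_eq h]
    rw [he]
    refine ⟨integrable_zero _ _ _, ?_⟩
    have := momentConst_nonneg n s 1
    rw [integral_zero, abs_zero]
    positivity
  · have he : (fun y => (gradCutoff s r y - (Metric.ball 0 r).indicator (fun _ => 1) y) * l y
        * K y) = (Metric.ball 0 r)ᶜ.indicator (fun y => l y * K y) := by
      ext y
      by_cases hy : y ∈ Metric.ball 0 r
      · rw [indicator_of_notMem (notMem_compl_iff.2 hy)]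
        simp [gradCutoff_of_gt h, -Metric.mem_ball, hy]
      · rw [indicator_of_mem (mem_compl hy)]
        simp [gradCutoff_of_gt h, -Metric.mem_ball, hy]
    have := hK.far (G := G) (β := 1) (g := fun y => l y) (by linarith) hr
      hlm (fun y _ => hl y)
    rw [he, integral_indicator Metric.isOpen_ball.measurableSet.compl,
      integrable_indicator_iff Metric.isOpen_ball.measurableSet.compl]
    exact this

end Kernel

/-! ### Cancellation on annuli and the absolutely convergent form of the operator -/

section Representation

variable {n : ℕ} [NeZero n] {s lam Lam : ℝ} {K : EuclideanSpace ℝ (Fin n) → ℝ}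

/-- Kernels with vanishing first moment on the sphere have vanishing first moment on annuli. -/
theorem IsStableKernel.setIntegral_annulus_smul (hK : IsStableKernel s K) (hs : s = 1 / 2)
    (ε r : ℝ) : ∫ y in {y : EuclideanSpace ℝ (Fin n) | ε < ‖y‖ ∧ ‖y‖ < r}, K y • y = 0 := by
  have hmeas : MeasurableSet {y : EuclideanSpace ℝ (Fin n) | ε < ‖y‖ ∧ ‖y‖ < r} :=
    (measurableSet_lt measurable_const measurable_norm).inter
      (measurableSet_lt measurable_norm measurable_const)
  set F : EuclideanSpace ℝ (Fin n) → EuclideanSpace ℝ (Fin n) :=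
    {y : EuclideanSpace ℝ (Fin n) | ε < ‖y‖ ∧ ‖y‖ < r}.indicator (fun y => K y • y) with hF
  rw [← integral_indicator hmeas]
  have h1 : ∫ y, F y = ∫ y : ({0}ᶜ : Set (EuclideanSpace ℝ (Fin n))), F y
      ∂(volume.comap Subtype.val) := by
    rw [integral_subtype_comap (measurableSet_singleton _).compl F, restrict_compl_singleton]
  rw [h1]
  -- By homogeneity the integrand is, in polar coordinates, this radial factor times `K θ • θ`.
  let f : Ioi (0 : ℝ) → ℝ := fun t => (Ioo ε r).indicator
    (fun t : ℝ => t ^ (-(n : ℝ) - 2 * s) * t) t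
  have h2 : ∀ y : ({0}ᶜ : Set (EuclideanSpace ℝ (Fin n))), F y =
      (fun p : Metric.sphere (0 : EuclideanSpace ℝ (Fin n)) 1 × Ioi (0 : ℝ) =>
        f p.2 • (K p.1 • (p.1 : EuclideanSpace ℝ (Fin n))))
      (homeomorphUnitSphereProd (EuclideanSpace ℝ (Fin n)) y) := by
    rintro ⟨y, hy⟩
    have hy0 : y ≠ 0 := hy
    have hn0 : 0 < ‖y‖ := norm_pos_iff.2 hy0
    have hKy : K y = ‖y‖ ^ (-(n : ℝ) - 2 * s) * K (‖y‖⁻¹ • y) := by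
      rw [← hK.homogeneous _ hn0 _ (smul_ne_zero (inv_ne_zero hn0.ne') hy0), smul_smul,
        mul_inv_cancel₀ hn0.ne', one_smul]
    by_cases h : ε < ‖y‖ ∧ ‖y‖ < r
    · have h' : ‖y‖ ∈ Ioo ε r := h
      simp only [hF, f, indicator, mem_ofPred_eq, h, and_self, if_true,
        homeomorphUnitSphereProd_apply_fst_coe, homeomorphUnitSphereProd_apply_snd_coe, mem_Ioo]
      rw [hKy, smul_smul, smul_smul]
      congr 1
      field_simp
    · simp [hF, f, indicator, h]
  rw [integral_congr_ae (Eventually.of_forall h2)]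
  refine (((volume : Measure (EuclideanSpace ℝ (Fin n))).measurePreserving_homeomorphUnitSphereProd
    ).integral_comp (Homeomorph.measurableEmbedding _) (fun p => f p.2 •
      (K p.1 • (p.1 : EuclideanSpace ℝ (Fin n))))).trans ?_
  refine (integral_prod_swap (fun p : Ioi (0 : ℝ) × Metric.sphere (0 : EuclideanSpace ℝ (Fin n)) 1
    => f p.1 • (K p.2 • (p.2 : EuclideanSpace ℝ (Fin n))))).trans ?_
  -- The product formula needs no integrability, so nonpositive `ε` is allowed; the angular factor
  -- is zero anyway.
  rw [integral_prod_smul f (fun θ : Metric.sphere (0 : EuclideanSpace ℝ (Fin n)) 1 =>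
    K θ • (θ : EuclideanSpace ℝ (Fin n))), hK.cancellation hs, smul_zero]

theorem IsStableKernel.isEllipticKernel (hK : IsStableKernel s K)
    (hb : ∀ y, y ≠ 0 → lam / ‖y‖ ^ ((n : ℝ) + 2 * s) ≤ K y ∧
      K y ≤ Lam / ‖y‖ ^ ((n : ℝ) + 2 * s)) : IsEllipticKernel s lam Lam K where
  aestronglyMeasurable := by
    have h := hK.locallyIntegrable.aestronglyMeasurable
    rwa [restrict_compl_singleton] at h
  nonneg := hK.nonneg
  annulus := hK.setIntegral_annulus_smul
  lower := fun y hy => by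
    rw [Real.rpow_neg (norm_nonneg y), ← div_eq_mul_inv]
    exact (hb y hy).1
  upper := fun y hy => by
    rw [Real.rpow_neg (norm_nonneg y), ← div_eq_mul_inv]
    exact (hb y hy).2

omit [NeZero n] in
-- The adjoint operator has kernel `K (-y)`, so the representation formula must be available for it
-- too.
theorem IsEllipticKernel.reflect (hK : IsEllipticKernel s lam Lam K) :
    IsEllipticKernel s lam Lam (fun y => K (-y)) where
  aestronglyMeasurable := hK.aestronglyMeasurable.comp_quasiMeasurePreserving
    (Measure.measurePreserving_neg volume).quasiMeasurePreserving
  nonneg := fun y hy => hK.nonneg _ (neg_ne_zero.2 hy)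
  annulus := fun hs ε r => by
    have h := hK.annulus hs ε r
    have hmeas : MeasurableSet {y : EuclideanSpace ℝ (Fin n) | ε < ‖y‖ ∧ ‖y‖ < r} :=
      (measurableSet_lt measurable_const measurable_norm).inter
        (measurableSet_lt measurable_norm measurable_const)
    rw [← integral_indicator hmeas] at h ⊢
    rw [← integral_neg_eq_self, ← neg_eq_zero, ← integral_neg, ← h]
    refine integral_congr_ae (Eventually.of_forall fun y => ?_)
    by_cases hy : ε < ‖y‖ ∧ ‖y‖ < r <;> simp [indicator, hy]
  lower := fun y hy => by simpa using hK.lower (-y) (neg_ne_zero.2 hy)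
  upper := fun y hy => by simpa using hK.upper (-y) (neg_ne_zero.2 hy)

theorem IsEllipticKernel.setIntegral_annulus_clm (hK : IsEllipticKernel s lam Lam K)
    (hs : s = 1 / 2) {ε r : ℝ} (hε : 0 < ε) (l : EuclideanSpace ℝ (Fin n) →L[ℝ] ℝ) :
    IntegrableOn (fun y => l y * K y) {y : EuclideanSpace ℝ (Fin n) | ε < ‖y‖ ∧ ‖y‖ < r} ∧
    ∫ y in {y : EuclideanSpace ℝ (Fin n) | ε < ‖y‖ ∧ ‖y‖ < r}, l y * K y = 0 := by
  have hsub : {y : EuclideanSpace ℝ (Fin n) | ε < ‖y‖ ∧ ‖y‖ < r} ⊆ (Metric.ball 0 ε)ᶜ := by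
    intro y hy
    simpa using hy.1.le
  have hmeas : MeasurableSet {y : EuclideanSpace ℝ (Fin n) | ε < ‖y‖ ∧ ‖y‖ < r} :=
    (measurableSet_lt measurable_const measurable_norm).inter
      (measurableSet_lt measurable_norm measurable_const)
  have hKi : IntegrableOn (fun y => K y • y) {y : EuclideanSpace ℝ (Fin n) | ε < ‖y‖ ∧ ‖y‖ < r} := by
    have h1 : IntegrableOn (fun y => K y * r) {y : EuclideanSpace ℝ (Fin n) | ε < ‖y‖ ∧ ‖y‖ < r} :=
      ((hK.integrableOn_far (by linarith) hε).mono_set hsub).mul_const r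
    refine Integrable.mono' h1.norm
      (hK.aestronglyMeasurable.smul aestronglyMeasurable_id).restrict ?_
    rw [ae_restrict_iff' hmeas]
    refine Eventually.of_forall fun y hy => ?_
    rw [norm_smul, norm_mul]
    refine mul_le_mul_of_nonneg_left ?_ (norm_nonneg _)
    exact hy.2.le.trans (le_abs_self r)
  have he : (fun y => l y * K y) = fun y => l (K y • y) := by
    ext y
    rw [map_smul, smul_eq_mul, mul_comm]
  rw [he]
  exact ⟨l.integrable_comp hKi, by
    rw [l.integral_comp_comm hKi, hK.annulus hs, map_zero]⟩

theorem tendsto_setIntegral_norm_gt {g : EuclideanSpace ℝ (Fin n) → ℝ} (hg : Integrable g) :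
    Tendsto (fun ε : ℝ => ∫ y in {y | ε < ‖y‖}, g y) (𝓝[>] 0) (𝓝 (∫ y, g y)) := by
  have hm : ∀ ε : ℝ, MeasurableSet {y : EuclideanSpace ℝ (Fin n) | ε < ‖y‖} := fun ε =>
    measurableSet_lt measurable_const measurable_norm
  simp_rw [← fun ε => integral_indicator (μ := volume) (f := g) (hm ε)]
  refine tendsto_integral_filter_of_dominated_convergence (fun y => ‖g y‖)
    (Eventually.of_forall fun ε => hg.aestronglyMeasurable.indicator (hm ε))
    (Eventually.of_forall fun ε => Eventually.of_forall fun y => norm_indicator_le_norm_self _ _)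
    hg.norm ?_
  filter_upwards [ae_ne_zero_euclidean] with y hy
  refine tendsto_const_nhds.congr' ?_
  filter_upwards [mem_nhdsWithin_of_mem_nhds (Iio_mem_nhds (norm_pos_iff.2 hy))] with ε hε
  rw [indicator_of_mem (show y ∈ {y : EuclideanSpace ℝ (Fin n) | ε < ‖y‖} from hε)]

/-- The operator in compensated form, with absolutely convergent integral. -/
theorem IsEllipticKernel.stableOp_eq (hK : IsEllipticKernel s lam Lam K)
    (b : EuclideanSpace ℝ (Fin n)) {v : EuclideanSpace ℝ (Fin n) → ℝ}
    {x : EuclideanSpace ℝ (Fin n)} {r : ℝ}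
    (hi : Integrable (fun y => (v x - v (x + y) + gradCutoff s r y * fderiv ℝ v x y) * K y)) :
    stableOp s K b v x =
      (∫ y, (v x - v (x + y) + gradCutoff s r y * fderiv ℝ v x y) * K y)
        + fderiv ℝ v x (criticalDrift s b) := by
  rcases lt_trichotomy s (1 / 2) with h | h | h
  · rw [stableOp, if_pos h, criticalDrift, if_neg h.ne]
    simp [gradCutoff_of_lt h]
  · have hcd : criticalDrift s b = b := if_pos h
    rw [stableOp, if_neg h.not_lt, if_pos h, hcd]
    congr 1
    refine Tendsto.limUnder_eq ?_
    refine (tendsto_setIntegral_norm_gt hi).congr' ?_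
    filter_upwards [self_mem_nhdsWithin] with ε hε
    have hm : MeasurableSet {y : EuclideanSpace ℝ (Fin n) | ε < ‖y‖} :=
      measurableSet_lt measurable_const measurable_norm
    -- The gradient term integrates to zero over `ε < ‖y‖ < r`. Inserting it leaves the truncated
    -- integrals unchanged and makes the limit an ordinary integral.
    obtain ⟨hai, ha0⟩ := hK.setIntegral_annulus_clm h (r := r) hε (fderiv ℝ v x)
    have hset : {y : EuclideanSpace ℝ (Fin n) | ε < ‖y‖ ∧ ‖y‖ < r} =
        {y : EuclideanSpace ℝ (Fin n) | ε < ‖y‖} ∩ Metric.ball 0 r := by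
      ext y
      simp
    have he : ∀ y, (v x - v (x + y)) * K y =
        (v x - v (x + y) + gradCutoff s r y * fderiv ℝ v x y) * K y -
        (Metric.ball 0 r).indicator (fun y => fderiv ℝ v x y * K y) y := by
      intro y
      by_cases hy : y ∈ Metric.ball 0 r
      · simp only [gradCutoff_of_eq h, indicator_of_mem hy]
        ring
      · simp only [gradCutoff_of_eq h, indicator_of_notMem hy]
        ring
    simp_rw [he]
    rw [hset] at hai ha0
    have hai' : IntegrableOn ((Metric.ball 0 r).indicator (fun y => fderiv ℝ v x y * K y))
        {y : EuclideanSpace ℝ (Fin n) | ε < ‖y‖} := by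
      rw [IntegrableOn, integrable_indicator_iff Metric.isOpen_ball.measurableSet, IntegrableOn,
        Measure.restrict_restrict Metric.isOpen_ball.measurableSet, inter_comm]
      exact hai
    rw [integral_sub hi.integrableOn hai', setIntegral_indicator Metric.isOpen_ball.measurableSet,
      ha0, sub_zero]
  · rw [stableOp, if_neg h.not_gt, if_neg h.ne', criticalDrift, if_neg h.ne']
    simp [gradCutoff_of_gt h]

omit [NeZero n] in
/-- The compensated increments split into a second order part near the origin, a first order part
and increments away from the origin. -/
theorem compensated_split (r : ℝ) (v : EuclideanSpace ℝ (Fin n) → ℝ)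
    (x : EuclideanSpace ℝ (Fin n)) (l : EuclideanSpace ℝ (Fin n) →L[ℝ] ℝ)
    (y : EuclideanSpace ℝ (Fin n)) :
    (v x - v (x + y) + gradCutoff s r y * l y) * K y =
      (Metric.ball 0 r).indicator (fun y => (v x - v (x + y) + l y) * K y) y
      + (gradCutoff s r y - (Metric.ball 0 r).indicator (fun _ => 1) y) * l y * K y
      + (Metric.ball 0 r)ᶜ.indicator (fun y => v x * K y - v (x + y) * K y) y := by
  by_cases hy : y ∈ Metric.ball 0 r
  · rw [indicator_of_mem hy, indicator_of_mem hy, indicator_of_notMem (notMem_compl_iff.2 hy)]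
    ring
  · rw [indicator_of_notMem hy, indicator_of_notMem hy, indicator_of_mem (mem_compl hy)]
    ring

/-- Integrability of the compensated increments, with a lower bound for the integral. -/
theorem IsEllipticKernel.compensated (hK : IsEllipticKernel s lam Lam K) (hs₀ : 0 < s)
    (hs₁ : s < 1) (hLam : 0 ≤ Lam) {r : ℝ} (hr : 0 < r) (hr1 : r ≤ 1)
    {u v : EuclideanSpace ℝ (Fin n) → ℝ} (hu : AEStronglyMeasurable u volume)
    (hui : Integrable (fun y => |u y| / (1 + ‖y‖ ^ ((n : ℝ) + 2 * s))))
    (hv : AEStronglyMeasurable v volume)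
    {x : EuclideanSpace ℝ (Fin n)} (hx : ‖x‖ ≤ 1) (l : EuclideanSpace ℝ (Fin n) →L[ℝ] ℝ) {A : ℝ}
    (hvu : ∀ y ∈ (Metric.ball 0 r)ᶜ, v (x + y) = u (x + y))
    (hA : ∀ y ∈ Metric.ball 0 r, |v x - v (x + y) + l y| ≤ A * ‖y‖ ^ 2) :
    Integrable (fun y => (v x - v (x + y) + gradCutoff s r y * l y) * K y) ∧
    v x * (∫ y in (Metric.ball 0 r)ᶜ, K y)
      - A * Lam * (momentConst n s 2 * r ^ (2 - 2 * s))
      - ‖l‖ * Lam * (momentConst n s 1 * r ^ (1 - 2 * s))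
      - Lam * ((1 + 3 ^ ((n : ℝ) + 2 * s)) * r ^ (-((n : ℝ) + 2 * s))) * tailNorm s u
    ≤ ∫ y, (v x - v (x + y) + gradCutoff s r y * l y) * K y := by
  have hm : AEStronglyMeasurable (fun y => v (x + y)) volume :=
    hv.comp_quasiMeasurePreserving (measurePreserving_add_left volume x).quasiMeasurePreserving
  have hb := Metric.isOpen_ball (x := (0 : EuclideanSpace ℝ (Fin n))) (ε := r)
    |>.measurableSet
  obtain ⟨hn1, hn2⟩ := hK.near (G := A) (β := 2) (g := fun y => v x - v (x + y) + l y)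
    (by linarith) hr
    ((aestronglyMeasurable_const.sub hm).add l.continuous.aestronglyMeasurable)
    (fun y hy => by simpa using hA y hy)
  obtain ⟨hf1, hf2⟩ := hK.first_order hLam hr (norm_nonneg l)
    l.continuous.aestronglyMeasurable l.le_opNorm
  obtain ⟨ht1, ht2⟩ := hK.tail hs₀ hLam hr hr1 hu hui hx
  -- Outside the ball `v` may be replaced by `u`, so the tail is measured by the norm of `u` and not
  -- by that of `v`.
  have hcongr := fun y hy => congrArg (· * K y) (hvu y hy)
  rw [← setIntegral_congr_fun hb.compl hcongr] at ht2
  rw [← integrableOn_congr_fun hcongr hb.compl] at ht1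
  have hc1 := (hK.integrableOn_far hs₀ hr).const_mul (v x)
  have i1 := (integrable_indicator_iff hb).2 hn1
  have i3 : Integrable ((Metric.ball 0 r)ᶜ.indicator (fun y => v x * K y - v (x + y) * K y)) :=
    (integrable_indicator_iff hb.compl).2 (hc1.sub ht1)
  have i2 : Integrable (fun y => (Metric.ball 0 r).indicator
      (fun y => (v x - v (x + y) + l y) * K y) y
      + (gradCutoff s r y - (Metric.ball 0 r).indicator (fun _ => 1) y) * l y * K y) := i1.add hf1
  simp_rw [compensated_split r v x l]
  refine ⟨i2.add i3, ?_⟩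
  rw [integral_add i2 i3, integral_add i1 hf1, integral_indicator hb,
    integral_indicator hb.compl, integral_sub hc1 ht1, integral_const_mul]
  have := (abs_le.1 hn2).1
  have := (abs_le.1 hf2).1
  have := (abs_le.1 ht2).2
  linarith

end Representation

/-! ### Viscosity subsolutions: the weighted maximum principle -/

section Viscosity

/-- Second order Taylor bound for `(q₀ / q) ^ n` with `q = q₀ (1 + z)`. In the induction the bounds
for `k` and for exponent one are multiplied; `|z| ≤ 1/2` turns the cubic and quartic terms into
multiples of `z ^ 2`. -/
theorem exists_inv_one_add_pow_le (n : ℕ) : ∃ A : ℝ, 0 ≤ A ∧ ∀ z : ℝ, |z| ≤ 1 / 2 →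
    ((1 + z) ^ n)⁻¹ ≤ 1 - n * z + A * z ^ 2 := by
  induction n with
  | zero => exact ⟨0, le_rfl, fun z _ => by simp⟩
  | succ k ih =>
    obtain ⟨A, hA, h⟩ := ih
    refine ⟨2 * A + 2 + 2 * k, by positivity, fun z hz => ?_⟩
    obtain ⟨hz1, hz2⟩ := abs_le.1 hz
    have hpos : 0 < 1 + z := by linarith
    have h1 : (1 + z)⁻¹ ≤ 1 - z + 2 * z ^ 2 := by
      rw [inv_le_iff_one_le_mul₀ hpos]
      nlinarith [mul_nonneg (sq_nonneg z) (show 0 ≤ 1 + 2 * z by linarith)]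
    have h2 := h z hz
    have h3 : 0 ≤ ((1 + z) ^ k)⁻¹ := by positivity
    have h4 : 0 ≤ (1 + z)⁻¹ := by positivity
    rw [pow_succ, mul_inv]
    refine (mul_le_mul h2 h1 h4 (h3.trans h2)).trans ?_
    have hk : (0 : ℝ) ≤ k := Nat.cast_nonneg k
    have hz2' := sq_nonneg z
    have e1 : A * z ^ 2 * (1 - z + 2 * z ^ 2) ≤ A * z ^ 2 * 2 :=
      mul_le_mul_of_nonneg_left (by nlinarith) (by positivity)
    have e2 : -(k * z) * (2 * z ^ 2) ≤ k * z ^ 2 := by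
      nlinarith [mul_nonneg (mul_nonneg hk hz2') (show 0 ≤ 1 + 2 * z by linarith)]
    push_cast
    nlinarith

theorem UpperSemicontinuousOn.max_zero_mul {X : Type*} [TopologicalSpace X] {S : Set X}
    {f g : X → ℝ} (hf : UpperSemicontinuousOn f S) (hg : Continuous g) (hg0 : ∀ x ∈ S, 0 ≤ g x) :
    UpperSemicontinuousOn (fun x => max (f x) 0 * g x) S := by
  intro x hx y hy
  have hlim : Tendsto (fun c : ℝ => c * g x) (𝓝[>] (max (f x) 0)) (𝓝 (max (f x) 0 * g x)) :=
    ((continuous_id.mul continuous_const).tendsto _).mono_left nhdsWithin_le_nhds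
  obtain ⟨c, hc, hc'⟩ := ((hlim.eventually (gt_mem_nhds hy)).and self_mem_nhdsWithin).exists
  have h0 : 0 < c := (le_max_right _ _).trans_lt hc'
  have h1 := hf x hx c ((le_max_left _ _).trans_lt hc')
  have h2 : ∀ᶠ x' in 𝓝[S] x, c * g x' < y :=
    (((continuous_const.mul hg).tendsto x).eventually (gt_mem_nhds hc)).filter_mono
      nhdsWithin_le_nhds
  filter_upwards [h1, h2, self_mem_nhdsWithin] with x' h1 h2 h3
  exact (mul_le_mul_of_nonneg_right (max_le h1.le h0.le) (hg0 x' h3)).trans_lt h2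

variable {n : ℕ} [NeZero n] {s lam Lam : ℝ} {K : EuclideanSpace ℝ (Fin n) → ℝ}

open Classical in
/-- The inequality obtained by testing a viscosity subsolution with a quadratic polynomial. -/
theorem IsViscositySubsolution.quadratic_test {b : EuclideanSpace ℝ (Fin n)}
    {u : EuclideanSpace ℝ (Fin n) → ℝ} {C₀ ρ : ℝ}
    (hvis : IsViscositySubsolution s K b (Metric.ball 0 ρ) (fun _ => C₀) u)
    (hK : IsEllipticKernel s lam Lam K) (hb : s = 1 / 2 → ‖b‖ ≤ Lam)
    (hs₀ : 0 < s) (hs₁ : s < 1) (hLam : 0 ≤ Lam) {r : ℝ} (hr : 0 < r) (hr1 : r ≤ 1)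
    (hu : AEStronglyMeasurable u volume)
    (hui : Integrable (fun y => |u y| / (1 + ‖y‖ ^ ((n : ℝ) + 2 * s))))
    {x₀ : EuclideanSpace ℝ (Fin n)} (hx₀ : ‖x₀‖ ≤ 1) (hball : Metric.ball x₀ r ⊆ Metric.ball 0 ρ)
    {p : EuclideanSpace ℝ (Fin n)} {B : ℝ} (hB : 0 ≤ B) (hu0 : 0 ≤ u x₀)
    (htouch : ∀ y ∈ Metric.ball 0 r, u (x₀ + y) ≤ u x₀ + inner ℝ p y + B * ‖y‖ ^ 2) :
    u x₀ * (lam * (momentConst n s 0 * r ^ (-(2 * s))))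
      - B * Lam * (momentConst n s 2 * r ^ (2 - 2 * s))
      - ‖p‖ * Lam * ((momentConst n s 1 + 1) * r ^ (1 - 2 * s))
      - Lam * ((1 + 3 ^ ((n : ℝ) + 2 * s)) * r ^ (-((n : ℝ) + 2 * s))) * tailNorm s u
    ≤ C₀ := by
  set φ : EuclideanSpace ℝ (Fin n) → ℝ := fun x =>
    u x₀ + inner ℝ p (x - x₀) + B * ‖x - x₀‖ ^ 2 with hφ
  have hφc : ContDiff ℝ 2 φ := by
    have : ContDiff ℝ 2 (fun x : EuclideanSpace ℝ (Fin n) => ‖x - x₀‖ ^ 2) :=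
      (contDiff_id.sub contDiff_const).norm_sq ℝ
    exact (contDiff_const.add (contDiff_const.inner ℝ (contDiff_id.sub contDiff_const))).add
      (contDiff_const.mul this)
  have hφx : φ x₀ = u x₀ := by simp [hφ]
  have hφd : HasFDerivAt φ (innerSL ℝ p) x₀ := by
    have h1 : HasFDerivAt (fun x => inner ℝ p (x - x₀)) (innerSL ℝ p) x₀ :=
      (innerSL ℝ p).hasFDerivAt.comp x₀ ((hasFDerivAt_id x₀).sub_const x₀)
    have h2 : HasFDerivAt (fun x => ‖x - x₀‖ ^ 2) (0 : EuclideanSpace ℝ (Fin n) →L[ℝ] ℝ) x₀ := by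
      have := ((hasFDerivAt_id x₀).sub_const x₀).norm_sq
      simpa using this
    have h3 := (h1.const_add (u x₀)).add (h2.const_mul B)
    rw [smul_zero, add_zero] at h3
    exact h3
  have hx₀ρ : x₀ ∈ Metric.ball 0 ρ := hball (Metric.mem_ball_self hr)
  have hsub := hvis.2 x₀ hx₀ρ r hr hball φ hφc hφx (by
    intro y hy
    have := htouch (y - x₀) (by simpa [dist_eq_norm] using hy)
    simpa [hφ] using this)
  set w := (Metric.ball x₀ r).piecewise φ u with hw
  have hwx : w x₀ = u x₀ := by
    rw [hw, piecewise_eq_of_mem _ _ _ (Metric.mem_ball_self hr), hφx]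
  have hwd : fderiv ℝ w x₀ = innerSL ℝ p := by
    refine (hφd.congr_of_eventuallyEq ?_).fderiv
    filter_upwards [Metric.ball_mem_nhds x₀ hr] with y hy
    exact piecewise_eq_of_mem _ _ _ hy
  have hwm : AEStronglyMeasurable w volume :=
    AEStronglyMeasurable.piecewise Metric.isOpen_ball.measurableSet
      hφc.continuous.aestronglyMeasurable.restrict hu.restrict
  obtain ⟨h1, h2⟩ := hK.compensated hs₀ hs₁ hLam hr hr1 hu hui hwm hx₀ (innerSL ℝ p) (A := B)
    (by
      intro y hy
      refine piecewise_eq_of_notMem _ _ _ ?_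
      simpa using hy)
    (by
      intro y hy
      have hy' : x₀ + y ∈ Metric.ball x₀ r := by simpa using hy
      rw [hwx, hw, piecewise_eq_of_mem _ _ _ hy']
      simp only [hφ, add_sub_cancel_left, innerSL_apply_apply]
      rw [show u x₀ - (u x₀ + inner ℝ p y + B * ‖y‖ ^ 2) + inner ℝ p y = -(B * ‖y‖ ^ 2) by ring,
        abs_neg, abs_of_nonneg (by positivity)])
  rw [← hwd] at h1
  rw [hK.stableOp_eq b h1, hwd] at hsub
  rw [hwx, innerSL_apply_norm] at h2
  rw [hwx] at hsub
  -- At `s = 1/2` the drift scales like the first order term, since `r ^ (1 - 2s) = 1`; it accounts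
  -- for the `+ 1` next to `momentConst n s 1`.
  have h3 : |innerSL ℝ p (criticalDrift s b)| ≤ ‖p‖ * Lam * r ^ (1 - 2 * s) := by
    by_cases h : s = 1 / 2
    · rw [criticalDrift, if_pos h, show 1 - 2 * s = 0 by linarith, Real.rpow_zero, mul_one]
      exact (abs_real_inner_le_norm p b).trans (mul_le_mul_of_nonneg_left (hb h) (norm_nonneg _))
    · rw [criticalDrift, if_neg h, map_zero, abs_zero]
      positivity
  have h4 := mul_le_mul_of_nonneg_left (hK.lower_far hs₀ hr) hu0
  have h5 := (abs_le.1 h3).1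
  linarith

/-- The polynomial touching from above at a maximum point of `u (ρ² - |x|²)ⁿ`. -/
theorem exists_quadratic_above (n : ℕ) : ∃ B : ℝ, 0 ≤ B ∧
    ∀ (u : EuclideanSpace ℝ (Fin n) → ℝ) (x₀ : EuclideanSpace ℝ (Fin n)) (q₀ r : ℝ),
      q₀ = 9 / 16 - ‖x₀‖ ^ 2 → 0 < q₀ → 0 ≤ u x₀ → r ≤ q₀ / 8 →
      (∀ x, ‖x‖ < 3 / 4 → u x * (9 / 16 - ‖x‖ ^ 2) ^ n ≤ u x₀ * q₀ ^ n) →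
      ∀ y ∈ Metric.ball 0 r, ‖x₀ + y‖ < 3 / 4 ∧
        u (x₀ + y) ≤ u x₀ + inner ℝ ((u x₀ * (2 * n / q₀)) • x₀) y
          + u x₀ * (B / q₀ ^ 2) * ‖y‖ ^ 2 := by
  obtain ⟨A, hA, hAz⟩ := exists_inv_one_add_pow_le n
  -- The `n` comes from `‖y‖ ^ 2` inside the linear term `-n z`, using `1 / q₀ ≤ 1 / q₀ ^ 2`; the `9
  -- A` comes from `|z| ≤ 3 ‖y‖ / q₀`.
  refine ⟨n + 9 * A, by positivity, fun u x₀ q₀ r hq hq0 hu hr hmax y hy => ?_⟩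
  have hyr : ‖y‖ < q₀ / 8 := by
    have : ‖y‖ < r := by simpa using hy
    linarith
  have hx0 : ‖x₀‖ ≤ 3 / 4 := by nlinarith [norm_nonneg x₀]
  have hq1 : q₀ ≤ 1 := by nlinarith [sq_nonneg ‖x₀‖]
  have hy0 := norm_nonneg y
  set i := inner ℝ x₀ y with hi
  have hi1 : |i| ≤ 3 / 4 * ‖y‖ :=
    (abs_real_inner_le_norm x₀ y).trans (mul_le_mul_of_nonneg_right hx0 hy0)
  obtain ⟨hi2, hi3⟩ := abs_le.1 hi1
  have hnorm : ‖x₀ + y‖ ^ 2 = ‖x₀‖ ^ 2 + 2 * i + ‖y‖ ^ 2 := norm_add_sq_real x₀ y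
  -- Relative change of the weight: its value at `x₀ + y` is `q₀ (1 + z)`. The restriction `‖y‖ < q₀
  -- / 8` gives `|z| ≤ 3/8`.
  set z := -(2 * i + ‖y‖ ^ 2) / q₀ with hz
  have hzq : z * q₀ = -(2 * i + ‖y‖ ^ 2) := by
    rw [hz]
    field_simp
  have hzabs : |z| ≤ 3 * ‖y‖ / q₀ := by
    rw [hz, abs_div, abs_of_pos hq0, abs_neg]
    gcongr
    rw [abs_le]
    constructor <;> nlinarith
  have hz2 : |z| ≤ 1 / 2 := by
    refine hzabs.trans ?_
    rw [div_le_iff₀ hq0]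
    linarith
  have hz1 : 0 < 1 + z := by linarith [(abs_le.1 hz2).1]
  have hqy : 9 / 16 - ‖x₀ + y‖ ^ 2 = q₀ * (1 + z) := by
    rw [hnorm]
    linarith
  have hlt : ‖x₀ + y‖ < 3 / 4 := by
    have : 0 < q₀ * (1 + z) := by positivity
    nlinarith [norm_nonneg (x₀ + y)]
  refine ⟨hlt, ?_⟩
  have h1 := hmax _ hlt
  rw [hqy, mul_pow, mul_comm (q₀ ^ n), ← mul_assoc] at h1
  have h2 : u (x₀ + y) * (1 + z) ^ n ≤ u x₀ := le_of_mul_le_mul_right h1 (by positivity)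
  have h3 : u (x₀ + y) ≤ u x₀ * ((1 + z) ^ n)⁻¹ := by
    rwa [← div_eq_mul_inv, le_div_iff₀ (by positivity)]
  refine h3.trans ((mul_le_mul_of_nonneg_left (hAz z hz2) hu).trans ?_)
  have hzsq : z ^ 2 ≤ 9 * ‖y‖ ^ 2 / q₀ ^ 2 := by
    calc z ^ 2 = |z| ^ 2 := (sq_abs z).symm
      _ ≤ (3 * ‖y‖ / q₀) ^ 2 := pow_le_pow_left₀ (abs_nonneg z) hzabs 2
      _ = _ := by ring
  have h4 : -(n * z) ≤ 2 * n / q₀ * i + n / q₀ ^ 2 * ‖y‖ ^ 2 := by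
    have : -(n * z) = 2 * n / q₀ * i + n / q₀ * ‖y‖ ^ 2 := by
      rw [hz]
      ring
    rw [this]
    gcongr
    nlinarith
  rw [inner_smul_left, ← hi]
  have h5 : 1 - n * z + A * z ^ 2 ≤
      1 + 2 * n / q₀ * i + (n + 9 * A) / q₀ ^ 2 * ‖y‖ ^ 2 := by
    have := mul_le_mul_of_nonneg_left hzsq hA
    have e : (n + 9 * A) / q₀ ^ 2 * ‖y‖ ^ 2 =
      n / q₀ ^ 2 * ‖y‖ ^ 2 + A * (9 * ‖y‖ ^ 2 / q₀ ^ 2) := by ring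
    linarith
  refine (mul_le_mul_of_nonneg_left h5 hu).trans_eq ?_
  simp only [conj_trivial]
  ring

/-- Multiplying by `r ^ (2s)` with `r = θ q₀` turns the two error terms into `b₂ θ² u₀` and `b₁ θ
u₀`, at most half of `a u₀` by `hsmall`. Multiplying then by `q₀ ^ n` turns the tail factor `r ^
(-n)` into the constant `θ ^ (-n)`. -/
theorem absorb_lower_order {n : ℕ} {s θ q₀ r a b₁ b₂ c u₀ C₀ N : ℝ} (hs₀ : 0 < s) (hs₁ : s < 1)
    (hθ : 0 < θ) (hθ1 : θ ≤ 1) (hq : 0 < q₀) (hq1 : q₀ ≤ 1) (hr : r = θ * q₀) (hu : 0 ≤ u₀)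
    (hb₂ : 0 ≤ b₂) (hc : 0 ≤ c) (hC : 0 ≤ C₀) (hN : 0 ≤ N)
    (hsmall : (b₁ + b₂) * θ ≤ a / 2)
    (h : u₀ * (a * r ^ (-(2 * s))) - u₀ / q₀ ^ 2 * b₂ * r ^ (2 - 2 * s)
      - u₀ / q₀ * b₁ * r ^ (1 - 2 * s) - c * r ^ (-((n : ℝ) + 2 * s)) * N ≤ C₀) :
    u₀ * q₀ ^ n * (a / 2) ≤ (1 + c * (θ ^ n)⁻¹) * (N + C₀) := by
  have hr0 : 0 < r := hr ▸ mul_pos hθ hq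
  have hr1 : r ≤ 1 := by rw [hr]; nlinarith
  set R := r ^ (2 * s) with hR
  have hR0 : 0 < R := Real.rpow_pos_of_pos hr0 _
  have hR1 : R ≤ 1 := Real.rpow_le_one hr0.le hr1 (by linarith)
  have e0 : r ^ (-(2 * s)) = R⁻¹ := Real.rpow_neg hr0.le _
  have e1 : r ^ (1 - 2 * s) = r * R⁻¹ := by
    rw [Real.rpow_sub hr0, Real.rpow_one, div_eq_mul_inv]
  have e2 : r ^ (2 - 2 * s) = r ^ 2 * R⁻¹ := by
    rw [Real.rpow_sub hr0, Real.rpow_two, div_eq_mul_inv]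
  have e3 : r ^ (-((n : ℝ) + 2 * s)) = (r ^ n)⁻¹ * R⁻¹ := by
    rw [neg_add, Real.rpow_add hr0, e0, Real.rpow_neg hr0.le, Real.rpow_natCast]
  rw [e0, e1, e2, e3] at h
  have h1 : u₀ * (a - b₂ * θ ^ 2 - b₁ * θ) ≤ R * C₀ + c * (r ^ n)⁻¹ * N := by
    have := mul_le_mul_of_nonneg_left h hR0.le
    have e : R * (u₀ * (a * R⁻¹) - u₀ / q₀ ^ 2 * b₂ * (r ^ 2 * R⁻¹) - u₀ / q₀ * b₁ * (r * R⁻¹)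
        - c * ((r ^ n)⁻¹ * R⁻¹) * N)
        = u₀ * (a - b₂ * θ ^ 2 - b₁ * θ) - c * (r ^ n)⁻¹ * N := by
      rw [hr]
      field_simp
    linarith
  have h2 : u₀ * (a / 2) ≤ u₀ * (a - b₂ * θ ^ 2 - b₁ * θ) := by
    refine mul_le_mul_of_nonneg_left ?_ hu
    nlinarith [mul_nonneg hb₂ hθ.le]
  have h3 : u₀ * (a / 2) ≤ C₀ + c * (r ^ n)⁻¹ * N :=
    (h2.trans h1).trans (by nlinarith)
  have h4 := mul_le_mul_of_nonneg_right h3 (pow_nonneg hq.le n)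
  have e4 : c * (r ^ n)⁻¹ * N * q₀ ^ n = c * (θ ^ n)⁻¹ * N := by
    rw [hr, mul_pow]
    field_simp
  have h5 : C₀ * q₀ ^ n ≤ C₀ := mul_le_of_le_one_right hC (pow_le_one₀ hq.le hq1)
  have h6 : 0 ≤ c * (θ ^ n)⁻¹ * C₀ := by positivity
  nlinarith

theorem sub_norm_sq_nonneg {n : ℕ} {y : EuclideanSpace ℝ (Fin n)} (hy : ‖y‖ ≤ 3 / 4) :
    0 ≤ 9 / 16 - ‖y‖ ^ 2 := by
  nlinarith [norm_nonneg y]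

/-- Local boundedness of viscosity subsolutions. -/
theorem exists_viscosity_bound (n : ℕ) [NeZero n] (s lam Lam : ℝ) (hs₀ : 0 < s) (hs₁ : s < 1)
    (hlam : 0 < lam) (hLam : 0 ≤ Lam) : ∃ C : ℝ, 0 < C ∧
    ∀ (K : EuclideanSpace ℝ (Fin n) → ℝ) (b : EuclideanSpace ℝ (Fin n)),
      IsEllipticKernel s lam Lam K → (s = 1 / 2 → ‖b‖ ≤ Lam) →
      ∀ (C₀ : ℝ), 0 < C₀ → ∀ u : EuclideanSpace ℝ (Fin n) → ℝ,
        Integrable (fun x => |u x| / (1 + ‖x‖ ^ ((n : ℝ) + 2 * s))) volume →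
        AEStronglyMeasurable u volume →
        IsViscositySubsolution s K b (Metric.ball 0 (7 / 8)) (fun _ => C₀) u →
        ∀ x ∈ Metric.ball (0 : EuclideanSpace ℝ (Fin n)) (1 / 2),
          u x ≤ C * (tailNorm s u + C₀) := by
  obtain ⟨B, hB, htouch⟩ := exists_quadratic_above n
  obtain ⟨a, ha⟩ : ∃ t : ℝ, t = lam * momentConst n s 0 := ⟨_, rfl⟩
  have ha0 : 0 < a := ha ▸ mul_pos hlam (momentConst_pos n (by linarith))
  obtain ⟨b₁, hb₁⟩ : ∃ t : ℝ, t = 2 * n * Lam * (momentConst n s 1 + 1) := ⟨_, rfl⟩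
  obtain ⟨b₂, hb₂⟩ : ∃ t : ℝ, t = B * Lam * momentConst n s 2 := ⟨_, rfl⟩
  obtain ⟨c, hc⟩ : ∃ t : ℝ, t = Lam * (1 + 3 ^ ((n : ℝ) + 2 * s)) := ⟨_, rfl⟩
  have hM1 := momentConst_nonneg n s 1
  have hM2 := momentConst_nonneg n s 2
  have hb₁0 : 0 ≤ b₁ := by rw [hb₁]; positivity
  have hb₂0 : 0 ≤ b₂ := by rw [hb₂]; positivity
  have hc0 : 0 ≤ c := by rw [hc]; positivity
  -- The bound `1/8` keeps `r` in the range where the quadratic touches from above; the other bound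
  -- is the absorption condition.
  obtain ⟨θ, hθ⟩ : ∃ t : ℝ, t = min (1 / 8) (a / 2 / (b₁ + b₂ + 1)) := ⟨_, rfl⟩
  have hθ0 : 0 < θ := hθ ▸ lt_min (by norm_num) (by positivity)
  have hθ8 : θ ≤ 1 / 8 := hθ ▸ min_le_left _ _
  have hθs : (b₁ + b₂) * θ ≤ a / 2 := by
    have h1 : θ * (b₁ + b₂ + 1) ≤ a / 2 :=
      (le_div_iff₀ (by positivity)).1 (hθ ▸ min_le_right _ _)
    nlinarith
  obtain ⟨D, hD⟩ : ∃ t : ℝ, t = (1 + c * (θ ^ n)⁻¹) / (a / 2) := ⟨_, rfl⟩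
  have hD0 : 0 < D := by rw [hD]; positivity
  -- On the ball of radius `1/2` the weight is at least `9/16 - 1/4 = 5/16`.
  refine ⟨(16 / 5) ^ n * D, by positivity, fun K b hK hb C₀ hC₀ u hui hu hvis x hx => ?_⟩
  have hN : 0 ≤ tailNorm s u := integral_nonneg fun y => by positivity
  have hx2 : ‖x‖ < 1 / 2 := by simpa using hx
  have hsub : Metric.closedBall (0 : EuclideanSpace ℝ (Fin n)) (3 / 4) ⊆ Metric.ball 0 (7 / 8) :=
    Metric.closedBall_subset_ball (by norm_num)
  have husc : UpperSemicontinuousOn (fun x => max (u x) 0 * (9 / 16 - ‖x‖ ^ 2) ^ n)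
      (Metric.closedBall 0 (3 / 4)) := by
    refine (hvis.1.mono hsub).max_zero_mul (by fun_prop) fun y hy => pow_nonneg
      (sub_norm_sq_nonneg (by simpa using hy)) n
  obtain ⟨x₀, hx₀, hmax⟩ := husc.exists_isMaxOn ⟨0, by norm_num⟩ (isCompact_closedBall _ _)
  have hx₀' : ‖x₀‖ ≤ 3 / 4 := by simpa using hx₀
  have hmax' : ∀ y : EuclideanSpace ℝ (Fin n), ‖y‖ ≤ 3 / 4 →
      max (u y) 0 * (9 / 16 - ‖y‖ ^ 2) ^ n ≤ max (u x₀) 0 * (9 / 16 - ‖x₀‖ ^ 2) ^ n :=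
    fun y hy => hmax (by simpa using hy)
  set q₀ := 9 / 16 - ‖x₀‖ ^ 2 with hq₀
  have hqx : 5 / 16 ≤ 9 / 16 - ‖x‖ ^ 2 := by nlinarith [norm_nonneg x]
  have key : max (u x₀) 0 * q₀ ^ n ≤ D * (tailNorm s u + C₀) := by
    have hrhs : 0 ≤ D * (tailNorm s u + C₀) := by positivity
    rcases le_or_gt (u x₀) 0 with h0 | h0
    · rw [max_eq_right h0, zero_mul]
      exact hrhs
    rw [max_eq_left h0.le] at hmax' ⊢
    have hq0 : 0 ≤ q₀ := sub_norm_sq_nonneg hx₀'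
    -- If the maximum point is on the sphere, the weight vanishes there because `n ≠ 0`, and the
    -- bound is trivial.
    rcases hq0.eq_or_lt with hq0 | hq0
    · rw [← hq0, zero_pow (NeZero.ne n), mul_zero]
      exact hrhs
    have hq1 : q₀ ≤ 1 := by linarith [sq_nonneg ‖x₀‖]
    set r := θ * q₀ with hr
    have hr0 : 0 < r := mul_pos hθ0 hq0
    have hr8 : r ≤ q₀ / 8 := by
      have := mul_le_mul_of_nonneg_right hθ8 hq0.le
      linarith
    have ht := htouch u x₀ q₀ r hq₀ hq0 h0.le hr8 (by
      intro y hy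
      exact (mul_le_mul_of_nonneg_right (le_max_left _ _)
        (pow_nonneg (sub_norm_sq_nonneg hy.le) n)).trans
        (hmax' y hy.le))
    have hball : Metric.ball x₀ r ⊆ Metric.ball 0 (7 / 8) := by
      intro y hy
      have := (ht (y - x₀) (by simpa [dist_eq_norm] using hy)).1
      rw [add_sub_cancel] at this
      simpa using this.trans (by norm_num)
    have hp : ‖(u x₀ * (2 * n / q₀)) • x₀‖ ≤ u x₀ / q₀ * (2 * n) := by
      rw [norm_smul, Real.norm_of_nonneg (by positivity)]
      calc u x₀ * (2 * n / q₀) * ‖x₀‖ ≤ u x₀ * (2 * n / q₀) * 1 :=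
            mul_le_mul_of_nonneg_left (by linarith) (by positivity)
        _ = _ := by ring
    have hq := hvis.quadratic_test hK hb hs₀ hs₁ hLam hr0 (by linarith) hu hui
      (by linarith) hball (by positivity) h0.le (fun y hy => (ht y hy).2)
    have hrp : 0 ≤ r ^ (1 - 2 * s) := by positivity
    have hp' := mul_le_mul_of_nonneg_right (mul_le_mul_of_nonneg_right hp hLam)
      (mul_nonneg (add_nonneg hM1 zero_le_one) hrp)
    have h := absorb_lower_order (n := n) (b₁ := b₁) (b₂ := b₂) (c := c) (a := a) hs₀ hs₁ hθ0
      (by linarith) hq0 hq1 hr h0.le hb₂0 hc0 hC₀.le hN hθs (by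
        refine le_trans (le_of_eq_of_le ?_ (sub_le_sub_right (sub_le_sub_left hp' _) _)) hq
        rw [ha, hb₁, hb₂, hc]
        ring)
    rw [hD, div_mul_eq_mul_div, le_div_iff₀ (by positivity)]
    exact h
  have h1 : u x * (5 / 16) ^ n ≤ D * (tailNorm s u + C₀) := by
    refine le_trans ?_ ((hmax' x (by linarith)).trans key)
    calc u x * (5 / 16) ^ n ≤ max (u x) 0 * (5 / 16) ^ n :=
          mul_le_mul_of_nonneg_right (le_max_left _ _) (by positivity)
      _ ≤ _ := mul_le_mul_of_nonneg_left (pow_le_pow_left₀ (by norm_num) hqx n) (le_max_right _ _)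
  calc u x = (16 / 5) ^ n * (u x * (5 / 16) ^ n) := by
        rw [mul_left_comm, ← mul_pow]
        norm_num
    _ ≤ (16 / 5) ^ n * (D * (tailNorm s u + C₀)) :=
        mul_le_mul_of_nonneg_left h1 (by positivity)
    _ = _ := by ring

end Viscosity

/-! ### Mollification -/

section Mollification

/-- Smooth nonnegative functions of integral one supported in the ball of radius `1/8`. -/
structure IsMollifier {n : ℕ} (ρ : EuclideanSpace ℝ (Fin n) → ℝ) : Prop where
  contDiff : ContDiff ℝ ∞ ρ
  nonneg : ∀ z, 0 ≤ ρ z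
  eq_zero : ∀ z, 1 / 8 < ‖z‖ → ρ z = 0
  integral : ∫ z, ρ z = 1

/-- The convolution of `ρ` and `u`. -/
noncomputable def mollify {n : ℕ} (ρ u : EuclideanSpace ℝ (Fin n) → ℝ)
    (x : EuclideanSpace ℝ (Fin n)) : ℝ := ∫ t, ρ (x - t) * u t

/-- A differentiable function whose derivative is Lipschitz near a point is approximated by its
first order Taylor polynomial to second order. -/
theorem abs_taylor_le {E : Type*} [NormedAddCommGroup E] [NormedSpace ℝ E] {f : E → ℝ}
    (hf : Differentiable ℝ f) {x y : E} {A : ℝ} (hA : 0 ≤ A)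
    (h : ∀ z, ‖z - x‖ ≤ ‖y‖ → ‖fderiv ℝ f z - fderiv ℝ f x‖ ≤ A * ‖z - x‖) :
    |f x - f (x + y) + fderiv ℝ f x y| ≤ A * ‖y‖ ^ 2 := by
  have h1 := Convex.norm_image_sub_le_of_norm_fderiv_le' (𝕜 := ℝ) (f := f) (C := A * ‖y‖)
    (s := Metric.closedBall x ‖y‖) (x := x) (y := x + y) (φ := fderiv ℝ f x)
    (fun z _ => hf z) (fun z hz => by
      rw [Metric.mem_closedBall, dist_eq_norm] at hz
      exact (h z hz).trans (mul_le_mul_of_nonneg_left hz hA)) (convex_closedBall _ _)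
    (Metric.mem_closedBall_self (norm_nonneg _)) (by simp)
  rw [add_sub_cancel_left, Real.norm_eq_abs, ← abs_neg] at h1
  calc _ = |-(f (x + y) - f x - fderiv ℝ f x y)| := by ring_nf
    _ ≤ _ := h1
    _ = _ := by ring

theorem ContDiff.exists_abs_taylor_le {E : Type*} [NormedAddCommGroup E] [NormedSpace ℝ E]
    {f : E → ℝ} (hf : ContDiff ℝ 2 f) (x : E) : ∃ A δ : ℝ, 0 < δ ∧
    ∀ y ∈ Metric.ball (0 : E) δ, |f x - f (x + y) + fderiv ℝ f x y| ≤ A * ‖y‖ ^ 2 := by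
  have h1 : ContDiff ℝ 1 (fderiv ℝ f) := hf.fderiv_right (by norm_num)
  obtain ⟨A, t, ht, hA⟩ := h1.contDiffAt (x := x) |>.exists_lipschitzOnWith
  obtain ⟨δ, hδ, hδt⟩ := Metric.mem_nhds_iff.1 ht
  refine ⟨A, δ, hδ, fun y hy => abs_taylor_le (hf.differentiable (by norm_num)) A.2 fun z hz => ?_⟩
  have hy' : ‖y‖ < δ := by simpa using hy
  rw [← dist_eq_norm, ← dist_eq_norm]
  refine hA.dist_le_mul z (hδt ?_) x (mem_of_mem_nhds ht)
  rw [Metric.mem_ball, dist_eq_norm]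
  exact hz.trans_lt hy'

variable {n : ℕ} {ρ u : EuclideanSpace ℝ (Fin n) → ℝ}

theorem IsMollifier.hasCompactSupport (hρ : IsMollifier ρ) : HasCompactSupport ρ :=
  HasCompactSupport.intro (isCompact_closedBall 0 (1 / 8)) fun z hz => hρ.eq_zero z (by
    simpa using hz)

theorem IsMollifier.integrable (hρ : IsMollifier ρ) : Integrable ρ :=
  hρ.contDiff.continuous.integrable_of_hasCompactSupport hρ.hasCompactSupport

theorem IsMollifier.fderiv_eq_zero (hρ : IsMollifier ρ) {z : EuclideanSpace ℝ (Fin n)}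
    (hz : 1 / 8 < ‖z‖) : fderiv ℝ ρ z = 0 := by
  have h : ρ =ᶠ[𝓝 z] fun _ => 0 := by
    filter_upwards [(isOpen_lt continuous_const continuous_norm).mem_nhds hz] with w hw
    exact hρ.eq_zero w hw
  rw [h.fderiv_eq]
  simp

theorem IsMollifier.differentiable (hρ : IsMollifier ρ) : Differentiable ℝ ρ :=
  hρ.contDiff.differentiable (by simp)

theorem IsMollifier.continuous_fderiv (hρ : IsMollifier ρ) : Continuous (fderiv ℝ ρ) :=
  hρ.contDiff.continuous_fderiv (by simp)

/-- A common bound for the derivatives of first and second order. -/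
theorem IsMollifier.exists_bounds (hρ : IsMollifier ρ) : ∃ A : ℝ, 0 ≤ A ∧
    (∀ z, ‖fderiv ℝ ρ z‖ ≤ A) ∧
    ∀ z y, |ρ z - ρ (z + y) + fderiv ℝ ρ z y| ≤ A * ‖y‖ ^ 2 := by
  have h2 : ContDiff ℝ 2 ρ := contDiff_infty.1 hρ.contDiff 2
  have h1 : ContDiff ℝ 1 (fderiv ℝ ρ) := h2.fderiv_right (by norm_num)
  obtain ⟨A, hA⟩ := h1.lipschitzWith_of_hasCompactSupport (hρ.hasCompactSupport.fderiv ℝ)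
    one_ne_zero
  obtain ⟨A', hA'⟩ := (hρ.hasCompactSupport.fderiv ℝ).exists_bound_of_continuous
    hρ.continuous_fderiv
  refine ⟨max A A', le_max_of_le_left A.2, fun z => (hA' z).trans (le_max_right _ _),
    fun z y => (abs_taylor_le hρ.differentiable A.2 fun w _ => ?_).trans
      (mul_le_mul_of_nonneg_right (le_max_left _ _) (by positivity))⟩
  rw [← dist_eq_norm, ← dist_eq_norm]
  exact hA.dist_le_mul w z

theorem mollify_eq_convolution (ρ u : EuclideanSpace ℝ (Fin n) → ℝ) :
    mollify ρ u = convolution ρ u (ContinuousLinearMap.lsmul ℝ ℝ) volume := by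
  ext x
  rw [convolution_eq_swap]
  rfl

theorem IsMollifier.continuous_mollify (hρ : IsMollifier ρ) (hu : LocallyIntegrable u) :
    Continuous (mollify ρ u) := by
  rw [mollify_eq_convolution]
  exact hρ.hasCompactSupport.continuous_convolution_left _ hρ.contDiff.continuous hu

theorem IsMollifier.integrable_mul (hρ : IsMollifier ρ) (hu : LocallyIntegrable u)
    (x : EuclideanSpace ℝ (Fin n)) : Integrable (fun t => ρ (x - t) * u t) :=
  (hρ.hasCompactSupport.convolutionExists_left (ContinuousLinearMap.lsmul ℝ ℝ)
    hρ.contDiff.continuous hu x).integrable_swap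

theorem IsMollifier.hasFDerivAt_mollify (hρ : IsMollifier ρ) (hu : LocallyIntegrable u)
    (x : EuclideanSpace ℝ (Fin n)) : DifferentiableAt ℝ (mollify ρ u) x ∧
    ∀ y, Integrable (fun t => fderiv ℝ ρ (x - t) y * u t) ∧
      fderiv ℝ (mollify ρ u) x y = ∫ t, fderiv ℝ ρ (x - t) y * u t := by
  have h := hρ.hasCompactSupport.hasFDerivAt_convolution_left (ContinuousLinearMap.lsmul ℝ ℝ)
    (hρ.contDiff.of_le (by simp)) hu x
  have hi := (((hρ.hasCompactSupport.fderiv ℝ).convolutionExists_left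
    ((ContinuousLinearMap.lsmul ℝ ℝ).precompL (EuclideanSpace ℝ (Fin n)))
    hρ.continuous_fderiv hu) x).integrable_swap
  rw [mollify_eq_convolution]
  refine ⟨h.differentiableAt, fun y => ⟨?_, ?_⟩⟩
  · have := (ContinuousLinearMap.apply ℝ ℝ y).integrable_comp hi
    simpa using this
  · rw [h.fderiv, convolution_eq_swap, ContinuousLinearMap.integral_apply hi]
    simp

/-- The weight varies by at most a fixed factor within distance one, which is why mollification
preserves the weighted space. -/
theorem one_add_norm_rpow_le_of_close {α : ℝ} (hα : 0 < α) {x t : EuclideanSpace ℝ (Fin n)}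
    (h : ‖x - t‖ ≤ 1) : 1 + ‖t‖ ^ α ≤ (1 + 2 ^ α) * (1 + ‖x‖ ^ α) := by
  have h1 : ‖t‖ ≤ 2 * max 1 ‖x‖ := by
    have h2 : ‖t‖ ≤ ‖x‖ + ‖x - t‖ := by
      have := norm_sub_norm_le t x
      rw [norm_sub_rev] at this
      linarith
    linarith [le_max_left 1 ‖x‖, le_max_right 1 ‖x‖]
  have h2 : ‖t‖ ^ α ≤ 2 ^ α * (max 1 ‖x‖) ^ α := by
    rw [← Real.mul_rpow (by norm_num) (by positivity)]
    exact Real.rpow_le_rpow (norm_nonneg _) h1 hα.le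
  have h3 : (max 1 ‖x‖) ^ α ≤ 1 + ‖x‖ ^ α := by
    have : 0 ≤ ‖x‖ ^ α := by positivity
    rcases max_cases 1 ‖x‖ with ⟨h, _⟩ | ⟨h, _⟩
    · rw [h, Real.one_rpow]
      linarith
    · rw [h]
      linarith
  have h4 : 0 ≤ ‖x‖ ^ α := by positivity
  have h5 : (0 : ℝ) ≤ 2 ^ α := by positivity
  nlinarith [mul_le_mul_of_nonneg_left h3 h5]

theorem continuous_weight {α : ℝ} (hα : 0 < α) :
    Continuous (fun x : EuclideanSpace ℝ (Fin n) => 1 + ‖x‖ ^ α) :=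
  continuous_const.add (continuous_norm.rpow_const fun _ => Or.inr hα.le)

theorem locallyIntegrable_of_weighted {α : ℝ} (hα : 0 < α) (hu : AEStronglyMeasurable u volume)
    (hui : Integrable (fun x => |u x| / (1 + ‖x‖ ^ α))) : LocallyIntegrable u := by
  have h := hui.locallyIntegrable.smul_continuous (continuous_weight hα)
  refine h.mono hu (Eventually.of_forall fun x => le_of_eq ?_)
  have : 0 < 1 + ‖x‖ ^ α := by positivity
  rw [smul_eq_mul, div_mul_cancel₀ _ this.ne', norm_abs_eq_norm]

/-- Mollification is bounded in the weighted `L¹` norm. -/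
theorem IsMollifier.weighted_mollify (hρ : IsMollifier ρ) {s : ℝ} (hs : 0 < s)
    (hu : AEStronglyMeasurable u volume)
    (hui : Integrable (fun x => |u x| / (1 + ‖x‖ ^ ((n : ℝ) + 2 * s)))) :
    Integrable (fun x => |mollify ρ u x| / (1 + ‖x‖ ^ ((n : ℝ) + 2 * s))) ∧
      tailNorm s (mollify ρ u) ≤ (1 + 2 ^ ((n : ℝ) + 2 * s)) * tailNorm s u := by
  have hα : 0 < (n : ℝ) + 2 * s := by positivity
  have hloc := locallyIntegrable_of_weighted hα hu hui
  set f : EuclideanSpace ℝ (Fin n) → ℝ := fun x => |u x| / (1 + ‖x‖ ^ ((n : ℝ) + 2 * s)) with hf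
  have hci : Integrable (mollify ρ f) := by
    rw [mollify_eq_convolution]
    exact hρ.integrable.integrable_convolution _ hui
  have hcint : ∫ x, mollify ρ f x = tailNorm s u := by
    rw [mollify_eq_convolution, integral_convolution _ hρ.integrable hui, hρ.integral]
    simp [tailNorm, hf]
  have hw : ∀ x : EuclideanSpace ℝ (Fin n), 0 < 1 + ‖x‖ ^ ((n : ℝ) + 2 * s) := fun x => by
    positivity
  -- The mollification of `u`, divided by the weight, is dominated by the mollification of `|u|`
  -- divided by the weight, whose integral is the norm of `u`.
  have hbound : ∀ x, |mollify ρ u x| / (1 + ‖x‖ ^ ((n : ℝ) + 2 * s)) ≤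
      (1 + 2 ^ ((n : ℝ) + 2 * s)) * mollify ρ f x := by
    intro x
    rw [div_le_iff₀ (hw x), mollify, mollify, mul_right_comm, ← integral_const_mul]
    refine norm_integral_le_of_norm_le (f := fun t => ρ (x - t) * u t)
      ((hρ.integrable_mul hui.locallyIntegrable x).const_mul _) (Eventually.of_forall fun t => ?_)
    rw [norm_mul, Real.norm_of_nonneg (hρ.nonneg _), Real.norm_eq_abs]
    by_cases h : ‖x - t‖ ≤ 1
    · have h1 := one_add_norm_rpow_le_of_close hα h
      have h2 : |u t| = f t * (1 + ‖t‖ ^ ((n : ℝ) + 2 * s)) := (div_mul_cancel₀ _ (hw t).ne').symm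
      have h3 : 0 ≤ f t := div_nonneg (abs_nonneg _) (hw t).le
      rw [h2]
      calc ρ (x - t) * (f t * (1 + ‖t‖ ^ ((n : ℝ) + 2 * s)))
          ≤ ρ (x - t) * (f t * ((1 + 2 ^ ((n : ℝ) + 2 * s)) * (1 + ‖x‖ ^ ((n : ℝ) + 2 * s)))) :=
            mul_le_mul_of_nonneg_left (mul_le_mul_of_nonneg_left h1 h3) (hρ.nonneg _)
        _ = _ := by ring
    · rw [hρ.eq_zero _ (by linarith [not_le.1 h])]
      simp
  have hm : AEStronglyMeasurable (fun x => |mollify ρ u x| / (1 + ‖x‖ ^ ((n : ℝ) + 2 * s)))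
      volume :=
    ((hρ.continuous_mollify hloc).abs.div (continuous_weight hα)
      fun x => (hw x).ne').aestronglyMeasurable
  have hi := Integrable.mono' (hci.const_mul (1 + 2 ^ ((n : ℝ) + 2 * s))) hm
    (Eventually.of_forall fun x => by
      rw [Real.norm_of_nonneg (div_nonneg (abs_nonneg _) (hw x).le)]
      exact hbound x)
  refine ⟨hi, ?_⟩
  rw [← hcint, ← integral_const_mul]
  exact integral_mono hi (hci.const_mul _) hbound

end Mollification

/-! ### Weak subsolutions: mollification and Fubini -/

section WeakSubsolution

variable {n : ℕ} [NeZero n] {s lam Lam : ℝ} {K ρ u : EuclideanSpace ℝ (Fin n) → ℝ}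

/-- The increments of a mollifier, weighted by the kernel and by `u`, are jointly integrable. -/
theorem IsMollifier.integrable_increments (hρ : IsMollifier ρ) (hK : IsEllipticKernel s lam Lam K)
    (hs₀ : 0 < s) (hs₁ : s < 1) (hLam : 0 ≤ Lam) {r : ℝ} (hr : 0 < r) (hr1 : r ≤ 1)
    (hu : AEStronglyMeasurable u volume)
    (hui : Integrable (fun y => |u y| / (1 + ‖y‖ ^ ((n : ℝ) + 2 * s))))
    {x : EuclideanSpace ℝ (Fin n)} (hx : ‖x‖ ≤ 1) :
    Integrable (fun p : EuclideanSpace ℝ (Fin n) × EuclideanSpace ℝ (Fin n) =>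
      (ρ (x - p.2) - ρ (x - p.2 + p.1) + gradCutoff s r p.1 * fderiv ℝ ρ (x - p.2) p.1) * K p.1
        * u p.2) (volume.prod volume) := by
  have hloc := locallyIntegrable_of_weighted (by positivity) hu hui
  obtain ⟨A, hA0, hA1, hA2⟩ := hρ.exists_bounds
  set I : EuclideanSpace ℝ (Fin n) → ℝ := (Metric.ball 0 r).indicator (fun _ => 1) with hI
  have hIm : Measurable I := measurable_indicator_ball r
  have hI1 : ∀ y ∈ Metric.ball 0 r, I y = 1 := fun y hy => indicator_of_mem hy _
  have hI0 : ∀ y, y ∉ Metric.ball 0 r → I y = 0 := fun y hy => indicator_of_notMem hy _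
  have hIm1 : AEStronglyMeasurable (fun p : EuclideanSpace ℝ (Fin n) × EuclideanSpace ℝ (Fin n) =>
      I p.1) (volume.prod volume) := (hIm.comp measurable_fst).aestronglyMeasurable
  have hχm1 : AEStronglyMeasurable (fun p : EuclideanSpace ℝ (Fin n) × EuclideanSpace ℝ (Fin n) =>
      gradCutoff s r p.1) (volume.prod volume) :=
    ((measurable_gradCutoff s r).comp measurable_fst).aestronglyMeasurable
  have hKm : AEStronglyMeasurable (fun p : EuclideanSpace ℝ (Fin n) × EuclideanSpace ℝ (Fin n) =>
      K p.1) (volume.prod volume) := hK.aestronglyMeasurable.comp_fst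
  have hum : AEStronglyMeasurable (fun p : EuclideanSpace ℝ (Fin n) × EuclideanSpace ℝ (Fin n) =>
      u p.2) (volume.prod volume) := hu.comp_snd
  have hρc := hρ.contDiff.continuous
  have hρ1 : AEStronglyMeasurable (fun p : EuclideanSpace ℝ (Fin n) × EuclideanSpace ℝ (Fin n) =>
      ρ (x - p.2)) (volume.prod volume) := by
    have : Continuous (fun p : EuclideanSpace ℝ (Fin n) × EuclideanSpace ℝ (Fin n) =>
      ρ (x - p.2)) := by fun_prop
    exact this.aestronglyMeasurable
  have hρ2 : AEStronglyMeasurable (fun p : EuclideanSpace ℝ (Fin n) × EuclideanSpace ℝ (Fin n) =>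
      ρ (x - p.2 + p.1)) (volume.prod volume) := by
    have : Continuous (fun p : EuclideanSpace ℝ (Fin n) × EuclideanSpace ℝ (Fin n) =>
      ρ (x - p.2 + p.1)) := by fun_prop
    exact this.aestronglyMeasurable
  have hρ3 : AEStronglyMeasurable (fun p : EuclideanSpace ℝ (Fin n) × EuclideanSpace ℝ (Fin n) =>
      fderiv ℝ ρ (x - p.2) p.1) (volume.prod volume) := by
    have hc := hρ.continuous_fderiv
    have : Continuous (fun p : EuclideanSpace ℝ (Fin n) × EuclideanSpace ℝ (Fin n) =>
      fderiv ℝ ρ (x - p.2) p.1) := by fun_prop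
    exact this.aestronglyMeasurable
  -- For `‖x‖ ≤ 1` and `‖y‖ < r ≤ 1`, all values of `ρ` and its derivative that occur vanish once
  -- `‖t‖ > 3`. So local integrability of `u` suffices for the near and first order parts.
  set U : EuclideanSpace ℝ (Fin n) → ℝ := fun t =>
    A * (Metric.closedBall (0 : EuclideanSpace ℝ (Fin n)) 3).indicator (fun t => |u t|) t with hU
  have hUi : Integrable U := by
    refine Integrable.const_mul ?_ A
    rw [integrable_indicator_iff Metric.isClosed_closedBall.measurableSet]
    exact (hloc.integrableOn_isCompact (isCompact_closedBall _ _)).abs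
  have hU1 : ∀ t : EuclideanSpace ℝ (Fin n), ‖t‖ ≤ 3 → U t = A * |u t| := fun t ht => by
    simp only [hU]
    rw [indicator_of_mem (by simpa using ht)]
  have hU0 : ∀ t, 0 ≤ U t := fun t =>
    mul_nonneg hA0 (indicator_nonneg (fun _ _ => abs_nonneg _) t)
  have hfar : ∀ t : EuclideanSpace ℝ (Fin n), 3 < ‖t‖ → 2 < ‖x - t‖ := fun t ht => by
    have := norm_sub_norm_le t x
    rw [norm_sub_rev] at this
    linarith
  have i1 : Integrable (fun p : EuclideanSpace ℝ (Fin n) × EuclideanSpace ℝ (Fin n) =>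
      I p.1 * (ρ (x - p.2) - ρ (x - p.2 + p.1) + fderiv ℝ ρ (x - p.2) p.1) * K p.1 * u p.2)
      (volume.prod volume) := by
    have hn : Integrable (fun y => (Metric.ball 0 r).indicator (fun y => ‖y‖ ^ 2 * K y) y) :=
      (integrable_indicator_iff Metric.isOpen_ball.measurableSet).2
      (hK.near (G := 1) (β := 2) (g := fun y => ‖y‖ ^ 2) (by linarith) hr (by fun_prop)
        (by simp)).1
    refine Integrable.mono' (hn.norm.mul_prod hUi)
      (((hIm1.mul ((hρ1.sub hρ2).add hρ3)).mul hKm).mul hum)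
      (Eventually.of_forall fun p => ?_)
    obtain ⟨y, t⟩ := p
    simp only
    by_cases hy : y ∈ Metric.ball 0 r
    · rw [hI1 y hy, indicator_of_mem hy, one_mul]
      rcases le_or_gt ‖t‖ 3 with ht | ht
      · rw [hU1 t ht, norm_mul, norm_mul, norm_mul, Real.norm_eq_abs, Real.norm_eq_abs (u t),
          Real.norm_of_nonneg (sq_nonneg ‖y‖)]
        calc _ ≤ A * ‖y‖ ^ 2 * ‖K y‖ * |u t| := by
              gcongr
              exact hA2 (x - t) y
          _ = _ := by ring
      · have h1 := hfar t ht
        have hy1 : ‖y‖ < r := by simpa using hy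
        have h2 : 1 / 8 < ‖x - t + y‖ := by
          have := norm_sub_norm_le (x - t) (-y)
          rw [sub_neg_eq_add, norm_neg] at this
          linarith
        rw [hρ.eq_zero _ (by linarith), hρ.eq_zero _ h2, hρ.fderiv_eq_zero (by linarith)]
        simp only [zero_apply, sub_zero, add_zero, zero_mul, norm_zero]
        exact mul_nonneg (norm_nonneg _) (hU0 t)
    · rw [hI0 y hy]
      simp only [zero_mul, norm_zero]
      exact mul_nonneg (norm_nonneg _) (hU0 t)
  have i2 : Integrable (fun p : EuclideanSpace ℝ (Fin n) × EuclideanSpace ℝ (Fin n) =>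
      (gradCutoff s r p.1 - I p.1) * fderiv ℝ ρ (x - p.2) p.1 * K p.1 * u p.2)
      (volume.prod volume) := by
    have hn := (hK.first_order hLam hr (l := fun y => ‖y‖) (G := 1) zero_le_one (by fun_prop)
      (by simp)).1
    refine Integrable.mono' (hn.norm.mul_prod hUi)
      ((((hχm1.sub hIm1).mul hρ3).mul hKm).mul hum) (Eventually.of_forall fun p => ?_)
    obtain ⟨y, t⟩ := p
    simp only
    rcases le_or_gt ‖t‖ 3 with ht | ht
    · rw [hU1 t ht, norm_mul, norm_mul, norm_mul, norm_mul, norm_mul, norm_norm,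
        Real.norm_eq_abs (u t)]
      calc _ ≤ ‖gradCutoff s r y - I y‖ * (A * ‖y‖) * ‖K y‖ * |u t| := by
            gcongr
            exact (ContinuousLinearMap.le_opNorm _ _).trans
              (mul_le_mul_of_nonneg_right (hA1 _) (norm_nonneg _))
        _ = _ := by ring
    · rw [hρ.fderiv_eq_zero (by linarith [hfar t ht])]
      simp only [zero_apply, mul_zero, zero_mul, norm_zero]
      exact mul_nonneg (norm_nonneg _) (hU0 t)
  have i3 : Integrable (fun p : EuclideanSpace ℝ (Fin n) × EuclideanSpace ℝ (Fin n) =>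
      ((1 - I p.1) * K p.1) * (ρ (x - p.2) * u p.2)) (volume.prod volume) := by
    refine Integrable.mul_prod (f := fun y => (1 - I y) * K y) ?_ (hρ.integrable_mul hloc x)
    refine ((integrable_indicator_iff Metric.isOpen_ball.measurableSet.compl).2
      (hK.integrableOn_far hs₀ hr)).congr (Eventually.of_forall fun y => ?_)
    by_cases hy : y ∈ Metric.ball 0 r
    · simp only [hI1 y hy, indicator_of_notMem (notMem_compl_iff.2 hy), sub_self, zero_mul]
    · simp only [hI0 y hy, indicator_of_mem (mem_compl hy), sub_zero, one_mul]
  -- This part does not separate in `y` and `t`. On the support of `ρ (x - t + y)` one has `‖t‖ ≤ 2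
  -- + ‖y‖`, so the kernel is bounded by the weight at `t`, and a convolution integrand of two
  -- integrable functions dominates.
  have i4 : Integrable (fun p : EuclideanSpace ℝ (Fin n) × EuclideanSpace ℝ (Fin n) =>
      (1 - I p.1) * K p.1 * ρ (x - p.2 + p.1) * u p.2) (volume.prod volume) := by
    set c := Lam * ((1 + 3 ^ ((n : ℝ) + 2 * s)) * r ^ (-((n : ℝ) + 2 * s)))
    have hc : 0 ≤ c := by positivity
    have hconv := (Integrable.convolution_integrand (ContinuousLinearMap.lsmul ℝ ℝ)
      (μ := volume) (ν := volume) hui (hρ.integrable.comp_add_left x)).const_mul c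
    refine Integrable.mono' hconv ((((aestronglyMeasurable_const.sub hIm1).mul hKm).mul hρ2).mul
      hum) (Eventually.of_forall fun p => ?_)
    obtain ⟨y, t⟩ := p
    simp only [ContinuousLinearMap.lsmul_apply, smul_eq_mul]
    have hz : x + (y - t) = x - t + y := by abel
    rw [hz]
    have hnn : 0 ≤ c * (|u t| / (1 + ‖t‖ ^ ((n : ℝ) + 2 * s)) * ρ (x - t + y)) :=
      mul_nonneg hc (mul_nonneg (by positivity) (hρ.nonneg _))
    by_cases hy : y ∈ Metric.ball 0 r
    · rw [hI1 y hy]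
      simpa using hnn
    rcases lt_or_ge (1 / 8) ‖x - t + y‖ with h | h
    · rw [hρ.eq_zero _ h]
      simp
    have hy' : r ≤ ‖y‖ := by simpa using hy
    have ht : ‖t‖ ≤ 2 + ‖y‖ := by
      have h1 : t = x + y - (x - t + y) := by abel
      have h2 : ‖t‖ ≤ ‖x + y‖ + ‖x - t + y‖ := by
        conv_lhs => rw [h1]
        exact norm_sub_le _ _
      linarith [norm_add_le x y]
    have hK1 := hK.mul_le_weight hs₀ hLam hr hr1 hy' ht
    have hK0 := hK.nonneg y (norm_pos_iff.1 (hr.trans_le hy'))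
    rw [hI0 y hy, sub_zero, one_mul, norm_mul, norm_mul, Real.norm_of_nonneg hK0,
      Real.norm_of_nonneg (hρ.nonneg _), Real.norm_eq_abs]
    calc K y * ρ (x - t + y) * |u t|
        ≤ (c * (1 + ‖t‖ ^ ((n : ℝ) + 2 * s))⁻¹) * ρ (x - t + y) * |u t| :=
          mul_le_mul_of_nonneg_right (mul_le_mul_of_nonneg_right hK1 (hρ.nonneg _))
            (abs_nonneg _)
      _ = _ := by rw [div_eq_mul_inv]; ring
  refine (((i1.add i2).add i3).sub i4).congr (Eventually.of_forall fun p => ?_)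
  simp only [Pi.add_apply, Pi.sub_apply]
  ring

omit [NeZero n] in
/-- The reflected and translated mollifier is an admissible test function. -/
theorem IsMollifier.tsupport_translate (hρ : IsMollifier ρ) (x : EuclideanSpace ℝ (Fin n)) :
    tsupport (fun t => ρ (x - t)) ⊆ Metric.closedBall x (1 / 8) := by
  refine closure_minimal (fun t ht => ?_) Metric.isClosed_closedBall
  rw [Metric.mem_closedBall, dist_comm, dist_eq_norm]
  by_contra h
  exact ht (hρ.eq_zero _ (not_le.1 h))

omit [NeZero n] in
theorem criticalDrift_neg (b : EuclideanSpace ℝ (Fin n)) :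
    criticalDrift s (-b) = -criticalDrift s b := by
  unfold criticalDrift
  split_ifs <;> simp

/-- Mollifying a weak subsolution yields a pointwise subsolution. -/
theorem IsWeakSubsolution.mollify_le {b : EuclideanSpace ℝ (Fin n)} {C₀ : ℝ}
    (hw : IsWeakSubsolution s K b (Metric.ball 0 1) (fun _ => C₀) u)
    (hρ : IsMollifier ρ) (hK : IsEllipticKernel s lam Lam K)
    (hs₀ : 0 < s) (hs₁ : s < 1) (hLam : 0 ≤ Lam) (hC₀ : 0 ≤ C₀) {r : ℝ} (hr : 0 < r) (hr1 : r ≤ 1)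
    (hu : AEStronglyMeasurable u volume)
    (hui : Integrable (fun y => |u y| / (1 + ‖y‖ ^ ((n : ℝ) + 2 * s))))
    {x : EuclideanSpace ℝ (Fin n)} (hx : ‖x‖ < 7 / 8) :
    Integrable (fun y => (mollify ρ u x - mollify ρ u (x + y)
      + gradCutoff s r y * fderiv ℝ (mollify ρ u) x y) * K y) ∧
    (∫ y, (mollify ρ u x - mollify ρ u (x + y)
      + gradCutoff s r y * fderiv ℝ (mollify ρ u) x y) * K y)
      + fderiv ℝ (mollify ρ u) x (criticalDrift s b) ≤ C₀ := by
  have hloc := locallyIntegrable_of_weighted (by positivity) hu hui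
  have hF := hρ.integrable_increments hK hs₀ hs₁ hLam hr hr1 hu hui (x := x) (by linarith)
  set F : EuclideanSpace ℝ (Fin n) → EuclideanSpace ℝ (Fin n) → ℝ := fun y t =>
    (ρ (x - t) - ρ (x - t + y) + gradCutoff s r y * fderiv ℝ ρ (x - t) y) * K y * u t with hFdef
  obtain ⟨-, hd⟩ := hρ.hasFDerivAt_mollify hloc x
  have hinner : ∀ y, (mollify ρ u x - mollify ρ u (x + y)
      + gradCutoff s r y * fderiv ℝ (mollify ρ u) x y) * K y = ∫ t, F y t := by
    intro y
    have e1 := hρ.integrable_mul hloc x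
    have e2 := hρ.integrable_mul hloc (x + y)
    have e3 : Integrable (fun t => ρ (x - t) * u t - ρ (x + y - t) * u t) := e1.sub e2
    rw [(hd y).2, mollify, mollify, ← integral_sub e1 e2, ← integral_const_mul,
      ← integral_add e3 ((hd y).1.const_mul _), ← integral_mul_const]
    refine integral_congr_ae (Eventually.of_forall fun t => ?_)
    simp only [hFdef, show x - t + y = x + y - t by abel]
    ring
  have hint : Integrable (fun y => ∫ t, F y t) := hF.integral_prod_left
  simp_rw [hinner]
  refine ⟨hint, ?_⟩
  -- After the swap, the inner integral in `y` is the adjoint operator applied to the test function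
  -- `η = ρ (x - ·)`, multiplied by `u t`.
  rw [integral_integral_swap (f := F) hF, (hd _).2,
    ← integral_add (hF.integral_prod_right) (hd _).1]
  set η : EuclideanSpace ℝ (Fin n) → ℝ := fun t => ρ (x - t) with hη
  have hηd : ∀ t y, fderiv ℝ η t y = -fderiv ℝ ρ (x - t) y := by
    intro t y
    have h1 := (hρ.differentiable (x - t)).hasFDerivAt.comp t
      ((hasFDerivAt_id t).const_sub x)
    rw [show η = ρ ∘ fun t => x - t from rfl, h1.fderiv]
    simp
  have hadj : (fun y => evenPart K y - oddPart K y) = fun y => K (-y) := by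
    ext y
    simp only [evenPart, oddPart]
    ring
  have hae : ∀ᵐ t, (∫ y, F y t) + fderiv ℝ ρ (x - t) (criticalDrift s b) * u t =
      u t * stableOpAdj s K b η t := by
    filter_upwards [hF.prod_left_ae] with t ht
    -- Fubini gives integrability only of the slices multiplied by `u t`; where `u t = 0` both sides
    -- vanish.
    by_cases hut : u t = 0
    · simp [hFdef, hut]
    set Q : EuclideanSpace ℝ (Fin n) → ℝ := fun y =>
      (ρ (x - t) - ρ (x - t + y) + gradCutoff s r y * fderiv ℝ ρ (x - t) y) * K y with hQ
    have h1 : Integrable Q := by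
      refine (ht.mul_const (u t)⁻¹).congr (Eventually.of_forall fun y => ?_)
      simp only [hQ]
      field_simp
    -- Since `η (t + y) = ρ (x - t - y)`, the substitution `y ↦ -y` exchanges `K` with its
    -- reflection, and the gradient of `η` has the opposite sign.
    have h2 : (fun y => (η t - η (t + y) + gradCutoff s r y * fderiv ℝ η t y) * K (-y)) =
        fun y => Q (-y) := by
      ext y
      simp only [hηd]
      simp only [hQ, hη, gradCutoff_neg, map_neg, show x - (t + y) = x - t + -y by abel]
    rw [stableOpAdj, hadj, hK.reflect.stableOp_eq (-b) (r := r) (by rw [h2]; exact h1.comp_neg),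
      h2, integral_neg_eq_self Q, hηd, criticalDrift_neg, map_neg, neg_neg]
    have h3 : ∫ y, F y t = (∫ y, Q y) * u t := integral_mul_const (u t) Q
    rw [h3]
    ring
  rw [integral_congr_ae hae]
  have hts := hρ.tsupport_translate x
  have hηc : ContDiff ℝ ∞ η := hρ.contDiff.comp (contDiff_const.sub contDiff_id)
  refine (hw η hηc (HasCompactSupport.of_support_subset_isCompact (isCompact_closedBall x (1 / 8))
    ((subset_tsupport _).trans hts)) (hts.trans fun t ht => ?_) fun t => hρ.nonneg _).trans ?_
  · rw [mem_ball_zero_iff]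
    rw [Metric.mem_closedBall, dist_eq_norm] at ht
    have := norm_sub_norm_le t x
    linarith
  · have hηi : Integrable η := hρ.integrable.comp_sub_left x
    have hη1 : ∫ t, η t = 1 := by rw [← hρ.integral]; exact integral_sub_left_eq_self ρ volume x
    rw [integral_const_mul]
    refine mul_le_of_le_one_right hC₀ ?_
    rw [← hη1]
    exact setIntegral_le_integral hηi (Eventually.of_forall fun t => hρ.nonneg _)

end WeakSubsolution

/-! ### From weak to viscosity subsolutions, and the conclusion -/

section Main

variable {n : ℕ} [NeZero n] {s lam Lam : ℝ} {K ρ u : EuclideanSpace ℝ (Fin n) → ℝ}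

omit [NeZero n] in
open Classical in
theorem weighted_piecewise {α : ℝ} (hα : 0 < α) {φ v : EuclideanSpace ℝ (Fin n) → ℝ}
    (hφ : Continuous φ) (hv : Integrable (fun y => |v y| / (1 + ‖y‖ ^ α)))
    (x : EuclideanSpace ℝ (Fin n)) (r : ℝ) :
    Integrable (fun y => |(Metric.ball x r).piecewise φ v y| / (1 + ‖y‖ ^ α)) := by
  have hb : MeasurableSet (Metric.ball x r) := Metric.isOpen_ball.measurableSet
  have hc : Continuous (fun y => |φ y| / (1 + ‖y‖ ^ α)) :=
    hφ.abs.div (continuous_weight hα) fun y => by positivity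
  have h1 : IntegrableOn (fun y => |φ y| / (1 + ‖y‖ ^ α)) (Metric.ball x r) :=
    (hc.continuousOn.integrableOn_compact (isCompact_closedBall x r)).mono_set
      Metric.ball_subset_closedBall
  refine (Integrable.piecewise hb h1 hv.integrableOn).congr (Eventually.of_forall fun y => ?_)
  by_cases hy : y ∈ Metric.ball x r
  · simp only [piecewise_eq_of_mem _ _ _ hy]
  · simp only [piecewise_eq_of_notMem _ _ _ hy]

open Classical in
/-- Mollifying a weak subsolution yields a viscosity subsolution. -/
theorem IsWeakSubsolution.isViscositySubsolution_mollify {b : EuclideanSpace ℝ (Fin n)} {C₀ : ℝ}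
    (hw : IsWeakSubsolution s K b (Metric.ball 0 1) (fun _ => C₀) u)
    (hρ : IsMollifier ρ) (hK : IsEllipticKernel s lam Lam K)
    (hs₀ : 0 < s) (hs₁ : s < 1) (hLam : 0 ≤ Lam) (hC₀ : 0 ≤ C₀)
    (hu : AEStronglyMeasurable u volume)
    (hui : Integrable (fun y => |u y| / (1 + ‖y‖ ^ ((n : ℝ) + 2 * s)))) :
    IsViscositySubsolution s K b (Metric.ball 0 (7 / 8)) (fun _ => C₀) (mollify ρ u) := by
  have hα : 0 < (n : ℝ) + 2 * s := by positivity
  have hloc := locallyIntegrable_of_weighted hα hu hui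
  have hvc := hρ.continuous_mollify hloc
  have hvi := (hρ.weighted_mollify hs₀ hu hui).1
  refine ⟨hvc.upperSemicontinuous.upperSemicontinuousOn _, ?_⟩
  intro x hx r hr _ φ hφ hφx hle
  have hx' : ‖x‖ < 7 / 8 := by simpa using hx
  set v := mollify ρ u with hv
  set w := (Metric.ball x r).piecewise φ v with hwdef
  have hwx : w x = v x := by
    rw [hwdef, piecewise_eq_of_mem _ _ _ (Metric.mem_ball_self hr), hφx]
  have hvw : ∀ y, v y ≤ w y := by
    intro y
    by_cases hy : y ∈ Metric.ball x r
    · rw [hwdef, piecewise_eq_of_mem _ _ _ hy]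
      exact hle y hy
    · rw [hwdef, piecewise_eq_of_notMem _ _ _ hy]
  have hφd := (hφ.differentiable (by norm_num)) x
  -- At the touching point `φ - v` has a local minimum, so both functions have the same gradient
  -- term and drift. As `w ≥ v` with equality at `x`, comparing the integrands gives `L w (x) ≤ L v
  -- (x)`.
  have hvd : fderiv ℝ v x = fderiv ℝ φ x := by
    have hmin : IsLocalMin (φ - v) x := by
      filter_upwards [Metric.ball_mem_nhds x hr] with y hy
      simpa [hφx] using hle y hy
    have := hmin.fderiv_eq_zero
    rw [fderiv_sub hφd (hρ.hasFDerivAt_mollify hloc x).1] at this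
    exact (sub_eq_zero.1 this).symm
  have hwd : fderiv ℝ w x = fderiv ℝ φ x := by
    refine Filter.EventuallyEq.fderiv_eq ?_
    filter_upwards [Metric.ball_mem_nhds x hr] with y hy
    exact piecewise_eq_of_mem _ _ _ hy
  have hwm : AEStronglyMeasurable w volume :=
    AEStronglyMeasurable.piecewise Metric.isOpen_ball.measurableSet
      hφ.continuous.aestronglyMeasurable.restrict hvc.aestronglyMeasurable.restrict
  have hwi := weighted_piecewise hα hφ.continuous hvi x r
  obtain ⟨A, δ, hδ, hA⟩ := hφ.exists_abs_taylor_le x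
  -- The compensated form is valid for every radius, so the radius can be shrunk to where the Taylor
  -- bound for `φ` holds.
  set r' := min 1 (min r δ) with hr'
  have hr'0 : 0 < r' := lt_min one_pos (lt_min hr hδ)
  have hr'1 : r' ≤ 1 := min_le_left _ _
  have hr'r : r' ≤ r := (min_le_right _ _).trans (min_le_left _ _)
  have hr'δ : r' ≤ δ := (min_le_right _ _).trans (min_le_right _ _)
  have hwint := (hK.compensated hs₀ hs₁ hLam hr'0 hr'1 hwm hwi hwm (by linarith)
    (fderiv ℝ φ x) (A := A) (fun _ _ => rfl) (by
      intro y hy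
      have hy' : x + y ∈ Metric.ball x r := by
        have := Metric.ball_subset_ball hr'r hy
        simpa using this
      rw [hwx, ← hφx, hwdef, piecewise_eq_of_mem _ _ _ hy']
      exact hA y (Metric.ball_subset_ball hr'δ hy))).1
  obtain ⟨hvint, hvle⟩ := hw.mollify_le hρ hK hs₀ hs₁ hLam hC₀ hr'0 hr'1 hu hui hx'
  rw [← hv, hvd] at hvint hvle
  rw [hK.stableOp_eq b (r := r') (by rw [hwd]; exact hwint), hwd]
  refine le_trans (add_le_add_left (integral_mono_ae hwint hvint ?_) _) hvle
  filter_upwards [ae_ne_zero_euclidean] with y hy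
  refine mul_le_mul_of_nonneg_right ?_ (hK.nonneg y hy)
  rw [hwx]
  linarith [hvw (x + y)]

omit [NeZero n] in
theorem IsViscositySubsolution.mono {b : EuclideanSpace ℝ (Fin n)}
    {Ω Ω' : Set (EuclideanSpace ℝ (Fin n))} {f : EuclideanSpace ℝ (Fin n) → ℝ}
    (h : IsViscositySubsolution s K b Ω f u) (hΩ : Ω' ⊆ Ω) :
    IsViscositySubsolution s K b Ω' f u :=
  ⟨h.1.mono hΩ, fun x hx r hr hb => h.2 x (hΩ hx) r hr (hb.trans hΩ)⟩

omit [NeZero n] in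
theorem ContDiffBump.isMollifier_normed (φ : ContDiffBump (0 : EuclideanSpace ℝ (Fin n)))
    (hφ : φ.rOut ≤ 1 / 8) : IsMollifier (φ.normed volume) where
  contDiff := φ.contDiff_normed
  nonneg := fun z => φ.nonneg_normed z
  eq_zero := fun z hz => by
    rw [← Function.notMem_support, φ.support_normed_eq, mem_ball_zero_iff, not_lt]
    linarith
  integral := φ.integral_normed

omit [NeZero n] in
/-- Locally integrable functions are almost everywhere limits of mollifications. -/
theorem exists_mollifiers (n : ℕ) : ∃ ρ : ℕ → EuclideanSpace ℝ (Fin n) → ℝ,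
    (∀ i, IsMollifier (ρ i)) ∧ ∀ u : EuclideanSpace ℝ (Fin n) → ℝ, LocallyIntegrable u →
      ∀ᵐ x, Tendsto (fun i => mollify (ρ i) u x) atTop (𝓝 (u x)) := by
  have hpos : ∀ i : ℕ, (0 : ℝ) < 1 / ((i : ℝ) + 1) := fun i => by positivity
  -- The ratio of outer to inner radius stays equal to `2`, as needed for almost everywhere
  -- convergence at Lebesgue points.
  let φ : ℕ → ContDiffBump (0 : EuclideanSpace ℝ (Fin n)) := fun i =>
    ⟨1 / 16 * (1 / ((i : ℝ) + 1)), 1 / 8 * (1 / ((i : ℝ) + 1)), by positivity,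
      by linarith [hpos i]⟩
  refine ⟨fun i => (φ i).normed volume, fun i => (φ i).isMollifier_normed ?_, fun u hu => ?_⟩
  · have : 1 / ((i : ℝ) + 1) ≤ 1 := by
      rw [div_le_one (by positivity)]
      linarith [Nat.cast_nonneg (α := ℝ) i]
    change 1 / 8 * (1 / ((i : ℝ) + 1)) ≤ 1 / 8
    linarith
  · have hlim : Tendsto (fun i => (φ i).rOut) atTop (𝓝 0) := by
      have := (tendsto_one_div_add_atTop_nhds_zero_nat (𝕜 := ℝ)).const_mul (1 / 8)
      rwa [mul_zero] at this
    have h := ContDiffBump.ae_convolution_tendsto_right_of_locallyIntegrable (μ := volume)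
      (φ := φ) (l := atTop) (K := 2) hlim (Eventually.of_forall fun i => by
        change 1 / 8 * (1 / ((i : ℝ) + 1)) ≤ 2 * (1 / 16 * (1 / ((i : ℝ) + 1)))
        linarith) hu
    simp_rw [mollify_eq_convolution]
    exact h

end Main

theorem mainTheorem7 (n : ℕ) (hn : 1 ≤ n) (s lam Lam : ℝ) (hs₀ : 0 < s) (hs₁ : s < 1)
    (hlam : 0 < lam) (hLam : lam ≤ Lam) :
    ∃ C : ℝ, 0 < C ∧
      ∀ (K : EuclideanSpace ℝ (Fin n) → ℝ) (b : EuclideanSpace ℝ (Fin n)),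
        IsStableKernel s K →
        (∀ y, y ≠ 0 → lam / ‖y‖ ^ ((n : ℝ) + 2 * s) ≤ K y ∧
          K y ≤ Lam / ‖y‖ ^ ((n : ℝ) + 2 * s)) →
        (s = 1 / 2 → ‖b‖ ≤ Lam) →
        ∀ (C₀ : ℝ), 0 < C₀ → ∀ u : EuclideanSpace ℝ (Fin n) → ℝ,
          Integrable (fun x => |u x| / (1 + ‖x‖ ^ ((n : ℝ) + 2 * s))) volume →
          AEStronglyMeasurable u volume →
          (IsWeakSubsolution s K b (Metric.ball 0 1) (fun _ => C₀) u →
            ∀ᵐ x ∂(volume.restrict (Metric.ball (0 : EuclideanSpace ℝ (Fin n)) (1 / 2))),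
              u x ≤ C * ((∫ y, |u y| / (1 + ‖y‖ ^ ((n : ℝ) + 2 * s))) + C₀)) ∧
          (IsViscositySubsolution s K b (Metric.ball 0 1) (fun _ => C₀) u →
            ∀ x ∈ Metric.ball (0 : EuclideanSpace ℝ (Fin n)) (1 / 2),
              u x ≤ C * ((∫ y, |u y| / (1 + ‖y‖ ^ ((n : ℝ) + 2 * s))) + C₀)) := by
  have : NeZero n := ⟨by lia⟩
  have hLam0 : 0 ≤ Lam := hlam.le.trans hLam
  obtain ⟨C, hC, hmain⟩ := exists_viscosity_bound n s lam Lam hs₀ hs₁ hlam hLam0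
  have hc1 : (1 : ℝ) ≤ 1 + 2 ^ ((n : ℝ) + 2 * s) := by
    have : (0 : ℝ) ≤ 2 ^ ((n : ℝ) + 2 * s) := by positivity
    linarith
  set c : ℝ := 1 + 2 ^ ((n : ℝ) + 2 * s) with hc
  -- The factor `c` is the price of mollification in the weighted norm; it is at least one, so the
  -- viscosity case may share the constant.
  refine ⟨C * c, by positivity, fun K b hK hKb hb C₀ hC₀ u hui hu => ?_⟩
  have hE := hK.isEllipticKernel hKb
  change (_ → ∀ᵐ x ∂_, u x ≤ C * c * (tailNorm s u + C₀)) ∧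
    (_ → ∀ x ∈ _, u x ≤ C * c * (tailNorm s u + C₀))
  have hN : 0 ≤ tailNorm s u := integral_nonneg fun y => by positivity
  constructor
  · intro hw
    obtain ⟨ρ, hρ, hlim⟩ := exists_mollifiers n
    have hloc := locallyIntegrable_of_weighted (by positivity) hu hui
    rw [ae_restrict_iff' Metric.isOpen_ball.measurableSet]
    filter_upwards [hlim u hloc] with x hx hxb
    refine le_of_tendsto hx (Eventually.of_forall fun i => ?_)
    obtain ⟨hvi, hvle⟩ := (hρ i).weighted_mollify hs₀ hu hui
    have h := hmain K b hE hb C₀ hC₀ (mollify (ρ i) u) hvi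
      ((hρ i).continuous_mollify hloc).aestronglyMeasurable
      (hw.isViscositySubsolution_mollify (hρ i) hE hs₀ hs₁ hLam0 hC₀.le hu hui) x hxb
    refine h.trans ?_
    rw [mul_assoc]
    refine mul_le_mul_of_nonneg_left ?_ hC.le
    have : C₀ ≤ c * C₀ := le_mul_of_one_le_left hC₀.le hc1
    linarith
  · intro hv x hx
    refine (hmain K b hE hb C₀ hC₀ u hui hu
      (hv.mono (Metric.ball_subset_ball (by norm_num))) x hx).trans ?_
    rw [mul_assoc]
    refine mul_le_mul_of_nonneg_left ?_ hC.le
    exact le_mul_of_one_le_left (by positivity) hc1
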